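/- **Setting.** Let $(R_i,Z_{1i},Z_{2i})$, $i=1,2,\dots$, be i.i.d., with $R_i\in\{0,1\}$, $Z_{2i}\in\mathbb R$ (used only when $R_i=1$) and $Z_{1i}$ in a measurable space; write $(R,Z_1,Z_2)$ for a generic observation. Data are missing at random, $\Pr(R=1\mid Z_1,Z_2)=\Pr(R=1\mid Z_1)$, and the parametric model $\pi(z_1;\gamma)$, $\gamma\in\Gamma\subseteq\mathbb R^p$, is correctly specified: $\Pr(R=1\mid Z_1)=\pi(Z_1;\gamma_0)>0$ a.s. Let $\psi_\mu,\psi_\sigma:\mathbb R\to\mathbb R$ be Borel functions, $\mathcal B\subset\mathbb R\times(0,\infty)$ the parameter space of $\beta=(\mu,\sigma)'$, $\beta_0=(\mu_0,\sigma_0)'\in\mathcal B$, $A=E\{\psi_\mu(\sigma_0^{-1}(Z_2-\mu_0))\}$, $B=E\{\psi_\sigma^2(\sigma_0^{-1}(Z_2-\mu_0))\}$, and $$m_\psi(Z_2;\beta)=\begin{pmatrix}\psi_\mu(\sigma^{-1}(Z_2-\mu))-A\\ \psi_\sigma^2(\sigma^{-1}(Z_2-\mu))-B\end{pmatrix},\qquad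 \varphi(Z,R;\beta,\gamma)=\frac{R}{\pi(Z_1;\gamma)}\,m_\psi(Z_2;\beta).$$ Let $m_\gamma(R,Z_1;\gamma)\in\mathbb R^p$ be an estimating function. With probability tending to one, let $\hat\gamma\in\Gamma$ solve $\sum_{i=1}^n m_\gamma(R_i,Z_{1i};\gamma)=0$ and let $\hat\beta=(\hat\mu,\hat\sigma)'\in\mathcal B$ (the robust IPW estimator) solve $\sum_{i=1}^n\varphi(Z_i,R_i;\beta,\hat\gamma)=0$. Assume $\hat\gamma\to\gamma_0$ in probability. **(a) Consistency.** $\hat\beta\to\beta_0$ in probability if: there is an open neighborhood $G$ of $\gamma_0$ on which a.s. $\gamma\mapsto\pi(Z_1;\gamma)$ is continuously differentiable, and $E\{\sup_{\beta\in\mathcal B,\gamma\in G}\|\varphi(Z,R;\beta,\gamma)\|\}<\infty$; $\mathcal B$ is compact and $E\{m_\psi(Z_2;\beta)\}=0$ with $\beta\in\mathcal B$ only for $\beta=\beta_0$; for some $\varepsilon>0$, $1\ge\pi(Z_1;\gamma_0)>\varepsilon$ a.s.; for each $(\mu,\sigma)'\in\mathcal B$, a.s. $\psi_\mu(\sigma^{-1}(Z_2-\mu))$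 and $\psi_\sigma(\sigma^{-1}(Z_2-\mu))$ are continuous in the parameter at $(\mu,\sigma)'$; and $E\{\sup_{\mathcal B}|\psi_\mu(\sigma^{-1}(Z_2-\mu))|^2\}+E\{\sup_{\mathcal B}|\psi_\sigma^2(\sigma^{-1}(Z_2-\mu))|^2\}<\infty$. **(b) Asymptotic normality.** Let $\theta=(\mu,\sigma,\gamma')'$, $\theta_0=(\mu_0,\sigma_0,\gamma_0')'$, and let $\tilde\varphi(\theta)$ stack $\varphi(Z,R;\beta,\gamma)$ and $m_\gamma(R,Z_1;\gamma)$. If $\hat\beta\to\beta_0$ in probability (for instance by (a)) and: $\theta_0$ is interior to $\mathcal B\times\Gamma$; $E\{\tilde\varphi(\theta_0)\}=0$ and $E\|\tilde\varphi(\theta_0)\|^2<\infty$; on a neighborhood $\mathcal N$ of $\theta_0$, $\tilde\varphi$ is a.s. continuously differentiable and $E\{\sup_{\theta\in\mathcal N}\|\nabla_\theta\tilde\varphi(\theta)\|\}<\infty$; and $E\{\nabla_\theta\tilde\varphi(\theta_0)\}'E\{\nabla_\theta\tilde\varphi(\theta_0)\}$ is nonsingular; then $IF(Z,R;\beta_0)$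 is square integrable and $$\sqrt n\,(\hat\beta-\beta_0)\overset{d}{\to}N\big(0,\,E\{IF(Z,R;\beta_0)\,IF(Z,R;\beta_0)'\}\big),$$ where $$IF(Z,R;\beta)=-\Big\{E\Big[\tfrac{\partial m_\psi(Z_2;\beta)}{\partial\beta'}\Big]\Big\}^{-1}\Big\{\varphi(Z,R;\beta,\gamma_0)-E\Big[\tfrac{\partial\varphi(Z,R;\beta,\gamma_0)}{\partial\gamma'}\Big]\Big\{E\Big[\tfrac{\partial m_\gamma(R,Z_1;\gamma_0)}{\partial\gamma'}\Big]\Big\}^{-1}m_\gamma(R,Z_1;\gamma_0)\Big\}.$$ **(c)** If $\psi_\mu$ and $\psi_\sigma$ are bounded, then $IF$ is bounded in $Z_2$: for fixed $\beta$ and fixed values of $R$ and $Z_1$ it is a bounded function of $Z_2$. -/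

import Mathlib

open MeasureTheory ProbabilityTheory Filter Topology Matrix

noncomputable section

namespace RIPW

/-- `ℝᵏ` with its Euclidean norm, coordinates indexed by `ι`. -/
abbrev Euc (ι : Type) [Fintype ι] : Type := EuclideanSpace ℝ ι

/-- One observation `(R, Z₁, Z₂)`: observation status, covariate, outcome. -/
abbrev Obs (𝒵 : Type*) : Type _ := ℝ × 𝒵 × ℝ

/-- The events `E n` have probability tending to one. -/
def WithProbToOne {Ω : Type*} [MeasurableSpace Ω] (P : Measure Ω) (E : ℕ → Set Ω) : Prop :=
  Tendsto (fun n => P (E n)ᶜ) atTop (𝓝 0)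

/-- `E {sup_{a ∈ S} F a} < ∞` for a nonnegative random function `F`, stated through an integrable
majorant of the supremum, so that no measurability of the supremum is presupposed. -/
def ExpSupFinite {Ω α : Type*} [MeasurableSpace Ω] (P : Measure Ω) (S : Set α)
    (F : Ω → α → ℝ) : Prop :=
  ∃ g : Ω → ℝ, Integrable g P ∧ ∀ᵐ ω ∂P, ∀ a ∈ S, F ω a ≤ g ω

/-- The matrix `E [∂ f / ∂ x']` at `x`, where `f` is a random vector-valued function of `x`. -/
def expJacobian {Ω : Type*} [MeasurableSpace Ω] (P : Measure Ω) {ι κ : Type}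
    [Fintype ι] [Fintype κ] [DecidableEq κ] (f : Ω → Euc κ → Euc ι) (x : Euc κ) :
    Matrix ι κ ℝ :=
  Matrix.of fun i j => ∫ ω, (fderiv ℝ (f ω) x (EuclideanSpace.single j 1)) i ∂P

/-- `(ψ_μ((z₂ - μ)/σ) - A, ψ_σ²((z₂ - μ)/σ) - B)'`, where `β = (μ, σ)'`. -/
def mPsi (ψμ ψσ : ℝ → ℝ) (A B : ℝ) (z₂ : ℝ) (β : Euc (Fin 2)) : Euc (Fin 2) :=
  !₂[ψμ ((z₂ - β 0) / β 1) - A, ψσ ((z₂ - β 0) / β 1) ^ 2 - B]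

/-- The inverse probability weighted estimating function: `(r / π(z₁; γ)) m_ψ(z₂; β)`. -/
def phi {𝒵 : Type*} {p : ℕ} (ψμ ψσ : ℝ → ℝ) (A B : ℝ) (π : 𝒵 → Euc (Fin p) → ℝ)
    (w : Obs 𝒵) (β : Euc (Fin 2)) (γ : Euc (Fin p)) : Euc (Fin 2) :=
  (w.1 / π w.2.1 γ) • mPsi ψμ ψσ A B w.2.2 β

/-- The parameter `θ = (μ, σ, γ')'`. -/
def joinParam {p : ℕ} (β : Euc (Fin 2)) (γ : Euc (Fin p)) : Euc (Fin 2 ⊕ Fin p) :=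
  WithLp.toLp 2 (Sum.elim β γ)

/-- The component `(μ, σ)'` of `θ`. -/
def betaPart {p : ℕ} (θ : Euc (Fin 2 ⊕ Fin p)) : Euc (Fin 2) :=
  WithLp.toLp 2 fun i => θ (Sum.inl i)

/-- The component `γ` of `θ`. -/
def gammaPart {p : ℕ} (θ : Euc (Fin 2 ⊕ Fin p)) : Euc (Fin p) :=
  WithLp.toLp 2 fun i => θ (Sum.inr i)

/-- The estimating functions for `(μ, σ)` and for `γ`, stacked, as a function of `θ`. -/
def phiStacked {𝒵 : Type*} {p : ℕ} (ψμ ψσ : ℝ → ℝ) (A B : ℝ) (π : 𝒵 → Euc (Fin p) → ℝ)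
    (mγ : ℝ → 𝒵 → Euc (Fin p) → Euc (Fin p)) (w : Obs 𝒵) (θ : Euc (Fin 2 ⊕ Fin p)) :
    Euc (Fin 2 ⊕ Fin p) :=
  joinParam (phi ψμ ψσ A B π w (betaPart θ) (gammaPart θ)) (mγ w.1 w.2.1 (gammaPart θ))

/-- The influence function at `β`, evaluated at the observation `w`; `Q` is the law of an observation
`W = (R, Z₁, Z₂)`, under which the expectations are taken:
`-{E[∂m_ψ/∂β']}⁻¹ {φ(w; β, γ₀) - E[∂φ(W; β, γ₀)/∂γ'] {E[∂m_γ(W; γ₀)/∂γ']}⁻¹ m_γ(w; γ₀)}`. -/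
def influence {𝒵 : Type*} [MeasurableSpace 𝒵] (Q : Measure (Obs 𝒵)) {p : ℕ}
    (ψμ ψσ : ℝ → ℝ) (A B : ℝ) (π : 𝒵 → Euc (Fin p) → ℝ)
    (mγ : ℝ → 𝒵 → Euc (Fin p) → Euc (Fin p)) (γ₀ : Euc (Fin p)) (β : Euc (Fin 2))
    (w : Obs 𝒵) : Euc (Fin 2) :=
  WithLp.toLp 2 (-((expJacobian Q (fun v => mPsi ψμ ψσ A B v.2.2) β)⁻¹ *ᵥ
    ((phi ψμ ψσ A B π w β γ₀).ofLp -
      expJacobian Q (fun v γ => phi ψμ ψσ A B π v β γ) γ₀ *ᵥ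
        ((expJacobian Q (fun v => mγ v.1 v.2.1) γ₀)⁻¹ *ᵥ (mγ w.1 w.2.1 γ₀).ofLp))))

/-- The matrix `E {X X'}` of a random vector `X`. -/
def secondMoment {Ω : Type*} [MeasurableSpace Ω] (P : Measure Ω) {ι : Type} [Fintype ι]
    (X : Ω → Euc ι) : Matrix ι ι ℝ :=
  Matrix.of fun i j => ∫ ω, X ω i * X ω j ∂P

/-- The law of the observation `(R, Z₁, Z₂)` with index `0`, the common law of all observations. -/
def obsLaw {Ω 𝒵 : Type*} [MeasurableSpace Ω] [MeasurableSpace 𝒵] (P : Measure Ω)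
    (R : ℕ → Ω → ℝ) (Z₁ : ℕ → Ω → 𝒵) (Z₂ : ℕ → Ω → ℝ) : Measure (Obs 𝒵) :=
  P.map fun ω => (R 0 ω, Z₁ 0 ω, Z₂ 0 ω)

/-- The data generating mechanism, with the model `π(·; γ)` for the missingness probability
correctly specified at `γ₀`. -/
structure DataModel {Ω 𝒵 : Type*} [MeasurableSpace Ω] [MeasurableSpace 𝒵] (P : Measure Ω)
    {p : ℕ} (R : ℕ → Ω → ℝ) (Z₁ : ℕ → Ω → 𝒵) (Z₂ : ℕ → Ω → ℝ)
    (π : 𝒵 → Euc (Fin p) → ℝ) (γ₀ : Euc (Fin p)) : Prop where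
  measurable_R : ∀ i, Measurable (R i)
  measurable_Z₁ : ∀ i, Measurable (Z₁ i)
  measurable_Z₂ : ∀ i, Measurable (Z₂ i)
  binary : ∀ i ω, R i ω = 0 ∨ R i ω = 1
  indep : iIndepFun (fun i ω => (R i ω, Z₁ i ω, Z₂ i ω)) P
  identDistrib : ∀ i, IdentDistrib (fun ω => (R i ω, Z₁ i ω, Z₂ i ω))
    (fun ω => (R 0 ω, Z₁ 0 ω, Z₂ 0 ω)) P P
  /-- Missing at random: `Pr(R = 1 | Z₂, Z₁)` is a function of `Z₁` alone. -/
  missingAtRandom :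
    P[R 0 | MeasurableSpace.comap (fun ω => (Z₁ 0 ω, Z₂ 0 ω)) inferInstance] =ᵐ[P]
      P[R 0 | MeasurableSpace.comap (Z₁ 0) inferInstance]
  /-- Correct specification: `Pr(R = 1 | Z₁) = π(Z₁; γ₀)`. -/
  correctlySpecified :
    P[R 0 | MeasurableSpace.comap (Z₁ 0) inferInstance] =ᵐ[P] fun ω => π (Z₁ 0 ω) γ₀
  positivity : ∀ᵐ ω ∂P, 0 < π (Z₁ 0 ω) γ₀
  measurable_π : ∀ γ, Measurable fun z => π z γ

/-- Regularity conditions for consistency; `ℬ` is the parameter space of `β = (μ, σ)'` and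
`Q` the law of an observation `w = (R, Z₁, Z₂)`. -/
structure ConsistencyConditions {𝒵 : Type*} [MeasurableSpace 𝒵] (Q : Measure (Obs 𝒵))
    {p : ℕ} (ψμ ψσ : ℝ → ℝ) (A B : ℝ) (π : 𝒵 → Euc (Fin p) → ℝ)
    (ℬ : Set (Euc (Fin 2))) (β₀ : Euc (Fin 2)) (γ₀ : Euc (Fin p)) : Prop where
  /-- Near `γ₀`, `π(Z₁; γ)` is continuously differentiable in `γ`, and the weighted estimating
  function is dominated, uniformly over `ℬ`. -/
  smooth_π : ∃ G : Set (Euc (Fin p)), IsOpen G ∧ γ₀ ∈ G ∧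
    (∀ᵐ w ∂Q, ContDiffOn ℝ 1 (π w.2.1) G) ∧
    ExpSupFinite Q (ℬ ×ˢ G) fun w x => ‖phi ψμ ψσ A B π w x.1 x.2‖
  compact : IsCompact ℬ
  /-- Identification: the moment equation holds at no other point of `ℬ`. -/
  identification : ∀ β ∈ ℬ, ∫ w, mPsi ψμ ψσ A B w.2.2 β ∂Q = 0 → β = β₀
  overlap : ∃ ε > 0, ∀ᵐ w ∂Q, ε < π w.2.1 γ₀ ∧ π w.2.1 γ₀ ≤ 1
  continuous_ψ : ∀ β ∈ ℬ, ∀ᵐ w ∂Q,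
    ContinuousAt (fun b : Euc (Fin 2) => ψμ ((w.2.2 - b 0) / b 1)) β ∧
    ContinuousAt (fun b : Euc (Fin 2) => ψσ ((w.2.2 - b 0) / b 1)) β
  moment_μ : ExpSupFinite Q ℬ fun w b => |ψμ ((w.2.2 - b 0) / b 1)| ^ 2
  moment_σ : ExpSupFinite Q ℬ fun w b => |ψσ ((w.2.2 - b 0) / b 1) ^ 2| ^ 2

/-- Regularity conditions for asymptotic normality; `ℬ` and `Γ` are the parameter spaces of
`β = (μ, σ)'` and `γ`, and `Q` is the law of an observation `w = (R, Z₁, Z₂)`. -/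
structure NormalityConditions {𝒵 : Type*} [MeasurableSpace 𝒵] (Q : Measure (Obs 𝒵))
    {p : ℕ} (ψμ ψσ : ℝ → ℝ) (A B : ℝ) (π : 𝒵 → Euc (Fin p) → ℝ)
    (mγ : ℝ → 𝒵 → Euc (Fin p) → Euc (Fin p)) (ℬ : Set (Euc (Fin 2))) (Γ : Set (Euc (Fin p)))
    (β₀ : Euc (Fin 2)) (γ₀ : Euc (Fin p)) : Prop where
  interior : joinParam β₀ γ₀ ∈ interior {θ | betaPart θ ∈ ℬ ∧ gammaPart θ ∈ Γ}
  mean_zero : ∫ w, phiStacked ψμ ψσ A B π mγ w (joinParam β₀ γ₀) ∂Q = 0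
  square_integrable : MemLp (fun w => phiStacked ψμ ψσ A B π mγ w (joinParam β₀ γ₀)) 2 Q
  /-- Continuous differentiability, with dominated derivative, in a neighborhood of `θ₀`. -/
  smooth : ∃ N : Set (Euc (Fin 2 ⊕ Fin p)), IsOpen N ∧ joinParam β₀ γ₀ ∈ N ∧
    (∀ᵐ w ∂Q, ContDiffOn ℝ 1 (phiStacked ψμ ψσ A B π mγ w) N) ∧
    ExpSupFinite Q N fun w θ => ‖fderiv ℝ (phiStacked ψμ ψσ A B π mγ w) θ‖
  nonsingular :
    IsUnit ((expJacobian Q (fun w => phiStacked ψμ ψσ A B π mγ w) (joinParam β₀ γ₀))ᵀ *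
      expJacobian Q (fun w => phiStacked ψμ ψσ A B π mγ w) (joinParam β₀ γ₀))

end RIPW

end

/-! Everything rests on one identity: under missing at random and correct specification, weighting
by `R / π(Z₁; γ₀)` leaves the expectation of every function of `(Z₁, Z₂)` unchanged
(`DataModel.integral_weight_smul`). Hence the weighted and unweighted moment equations agree at
`γ₀`, and so do their derivatives in `β`.

Consistency follows Wald's scheme. At any `β ≠ β₀` in `ℬ` the mean of `phi` is nonzero by
identification. On a small neighborhood of `(β, γ₀)` the oscillation of `phi` has an integrable
majorant whose mean is smaller than the norm of that mean (`exists_majorant_phi`), so by the law of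
large numbers the estimating equation has no root there, with probability tending to one. Finitely
many such neighborhoods cover the part of the compact `ℬ` away from `β₀`.

Asymptotic normality treats `(βhat, γhat)` as one Z-estimator. A first-order expansion, whose
remainder divided by `‖θ - θ₀‖` has a majorant of small mean (`exists_majorant_remainder`), shows
that `√n (θhat - θ₀)` differs by a term vanishing in probability from minus the inverse expected
Jacobian applied to the normalized sum of scores (`tendstoInMeasure_zEstimator_expansion`). The
Jacobian is block upper triangular, because `mγ` does not involve `β`; solving the block system for
its first component yields the influence function. The central limit theorem and Slutsky's lemma
conclude.

Suprema over neighborhoods need not be measurable. Both majorants come from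
`exists_majorant_integral_le`, which only asks for measurability of the sets of observations on
which the function is uniformly small. -/

noncomputable section

namespace RIPW

/-! ### Events of probability tending to one -/

section WithProbToOne

variable {Ω : Type*} [MeasurableSpace Ω] {P : Measure Ω}

lemma WithProbToOne.mono {E F : ℕ → Set Ω} (hE : WithProbToOne P E)
    (h : ∀ᶠ n in atTop, E n ⊆ F n) : WithProbToOne P F := by
  refine tendsto_of_tendsto_of_tendsto_of_le_of_le' tendsto_const_nhds hE
    (.of_forall fun _ => zero_le) ?_
  filter_upwards [h] with n hn
  exact measure_mono (Set.compl_subset_compl.2 hn)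

lemma WithProbToOne.of_ae {E : ℕ → Set Ω} (h : ∀ᵐ ω ∂P, ∀ n, ω ∈ E n) : WithProbToOne P E := by
  have : ∀ n, P (E n)ᶜ = 0 := fun n => by
    have := ae_all_iff.1 h n
    exact this
  simp [WithProbToOne, this]

lemma WithProbToOne.inter {E F : ℕ → Set Ω} (hE : WithProbToOne P E) (hF : WithProbToOne P F) :
    WithProbToOne P fun n => E n ∩ F n := by
  have := Tendsto.add hE hF
  rw [add_zero] at this
  refine tendsto_of_tendsto_of_tendsto_of_le_of_le tendsto_const_nhds this
    (fun _ => zero_le) fun n => ?_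
  simp only [Set.compl_inter]
  exact measure_union_le _ _

lemma WithProbToOne.biInter {ι : Type*} (s : Finset ι) {E : ι → ℕ → Set Ω}
    (hE : ∀ i ∈ s, WithProbToOne P (E i)) : WithProbToOne P fun n => ⋂ i ∈ s, E i n := by
  classical
  induction s using Finset.induction_on with
  | empty => simp [WithProbToOne]
  | insert i s hi ih =>
    simp only [Finset.mem_insert, forall_eq_or_imp] at hE
    simpa only [Finset.set_biInter_insert] using hE.1.inter (ih hE.2)

/-- Recasts convergence in probability as statements about events, so that finitely many asymptotic
facts can be intersected and then used at a single sample point. -/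
lemma tendstoInMeasure_iff_withProbToOne {E : Type*} [SeminormedAddCommGroup E]
    {f : ℕ → Ω → E} {g : Ω → E} :
    TendstoInMeasure P f atTop g ↔
      ∀ ε, 0 < ε → WithProbToOne P fun n => {ω | ‖f n ω - g ω‖ < ε} := by
  rw [tendstoInMeasure_iff_norm]
  simp [WithProbToOne, Set.compl_def]

end WithProbToOne

/-! ### Averages of i.i.d. observations, and majorants of small mean -/

section Sampling

variable {Ω 𝒲 : Type*} [MeasurableSpace Ω] [MeasurableSpace 𝒲] {P : Measure Ω}
  {W : ℕ → Ω → 𝒲}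

lemma ae_forall_of_ae_law (hW : ∀ i, Measurable (W i))
    (hd : ∀ i, IdentDistrib (W i) (W 0) P P) {p : 𝒲 → Prop}
    (hp : ∀ᵐ w ∂(P.map (W 0)), p w) : ∀ᵐ ω ∂P, ∀ i, p (W i ω) := by
  refine ae_all_iff.2 fun i => ?_
  rw [← (hd i).map_eq] at hp
  exact ae_of_ae_map (hW i).aemeasurable hp

/-- Weak law of large numbers for a function of i.i.d. observations. -/
lemma tendstoInMeasure_average [IsProbabilityMeasure P] {E : Type*} [NormedAddCommGroup E]
    [NormedSpace ℝ E] [CompleteSpace E] [MeasurableSpace E] [BorelSpace E]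
    [SecondCountableTopology E]
    (hW : ∀ i, Measurable (W i)) (hi : iIndepFun W P)
    (hd : ∀ i, IdentDistrib (W i) (W 0) P P) {f : 𝒲 → E} (hf : Integrable f (P.map (W 0))) :
    TendstoInMeasure P (fun (n : ℕ) ω => (n : ℝ)⁻¹ • ∑ i ∈ Finset.range n, f (W i ω)) atTop
      fun _ => ∫ w, f w ∂(P.map (W 0)) := by
  -- Independence and equality in law pass to measurable functions, so `f` is replaced by a
  -- measurable representative, which almost surely agrees with it at all observations at once.
  have hfm := hf.aestronglyMeasurable
  have hg : Measurable (hfm.mk f) := hfm.stronglyMeasurable_mk.measurable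
  have hae := ae_forall_of_ae_law hW hd hfm.ae_eq_mk
  refine tendstoInMeasure_of_tendsto_ae (fun n => ?_) ?_
  · refine AEStronglyMeasurable.const_smul (Finset.aestronglyMeasurable_fun_sum _ fun i _ => ?_) _
    refine AEStronglyMeasurable.comp_measurable ?_ (hW i)
    rwa [(hd i).map_eq]
  · have hint : Integrable (fun ω => hfm.mk f (W 0 ω)) P :=
      (hf.congr hfm.ae_eq_mk).comp_measurable (hW 0)
    have := strong_law_ae (fun i ω => hfm.mk f (W i ω)) hint
      (fun i j hij => (hi.indepFun hij).comp hg hg) (fun i => (hd i).comp hg)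
    rw [integral_congr_ae hfm.ae_eq_mk, integral_map (hW 0).aemeasurable
      hg.aestronglyMeasurable]
    filter_upwards [this, hae] with ω h1 h2
    simpa only [h2] using h1

/-- A random function which is dominated by an integrable `g`, and which is at most `η` on a set of
observations that exhausts the sample space as the neighborhood `U k` shrinks, has a majorant with
small expectation on some `U k`. -/
lemma exists_majorant_integral_le {α : Type*} {Q : Measure 𝒲} [IsProbabilityMeasure Q]
    {F : 𝒲 → α → ℝ} {U : ℕ → Set α} {g : 𝒲 → ℝ} (hg : Integrable g Q) (hg0 : 0 ≤ g)
    (hFg : ∀ᵐ w ∂Q, ∀ k, ∀ x ∈ U k, F w x ≤ g w)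
    {η : ℝ} (hη : 0 < η) {S : ℕ → Set 𝒲} (hS : ∀ k, NullMeasurableSet (S k) Q)
    (hmono : Monotone S) (hcover : ∀ᵐ w ∂Q, ∃ k, w ∈ S k)
    (hsmall : ∀ᵐ w ∂Q, ∀ k, w ∈ S k → ∀ x ∈ U k, F w x ≤ η) :
    ∃ k, ∃ h : 𝒲 → ℝ, Integrable h Q ∧ ∫ w, h w ∂Q ≤ 2 * η ∧
      ∀ᵐ w ∂Q, ∀ x ∈ U k, F w x ≤ h w := by
  -- Almost every `w` lies in all `S k` from some `k` on, so the truncation of `g` to the complement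
  -- vanishes eventually, and `g` dominates.
  have hlim : Tendsto (fun k => ∫ w, (S k)ᶜ.indicator g w ∂Q) atTop (𝓝 (∫ _, (0 : ℝ) ∂Q)) := by
    refine tendsto_integral_of_dominated_convergence g
      (fun k => hg.aestronglyMeasurable.indicator₀ (hS k).compl) hg
      (fun k => .of_forall fun w => ?_) ?_
    · rw [Real.norm_of_nonneg (Set.indicator_nonneg (f := g) (fun _ _ => hg0 _) _)]
      exact Set.indicator_le_self' (fun _ _ => hg0 _) _
    · filter_upwards [hcover] with w ⟨k, hk⟩
      refine tendsto_const_nhds.congr' ?_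
      filter_upwards [eventually_ge_atTop k] with l hl
      rw [Set.indicator_of_notMem]
      simpa using hmono hl hk
  rw [integral_zero] at hlim
  obtain ⟨k, hk⟩ := (hlim.eventually (gt_mem_nhds hη)).exists
  have hint : Integrable ((S k)ᶜ.indicator g) Q := hg.indicator₀ (hS k).compl
  -- The bound `η` serves on `S k` and `g` serves off it; each part contributes at most `η` to the
  -- mean.
  refine ⟨k, fun w => η + (S k)ᶜ.indicator g w, (integrable_const η).add hint, ?_, ?_⟩
  · rw [integral_add (integrable_const η) hint]
    simp only [integral_const, probReal_univ, one_smul]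
    linarith
  · filter_upwards [hFg, hsmall] with w h1 h2 x hx
    by_cases hw : w ∈ S k
    · simpa [hw] using h2 k hw x hx
    · simpa [hw] using (h1 k x hx).trans (by linarith)

end Sampling

/-! ### Multivariate central limit theorem and boundedness in probability -/

section CentralLimit

variable {Ω : Type*} [MeasurableSpace Ω] {P : Measure Ω} {ι : Type} [Fintype ι]

lemma integrable_mul_coord {X : Ω → Euc ι} (hX : MemLp X 2 P) (i j : ι) :
    Integrable (fun ω => X ω i * X ω j) P := by
  have h : ∀ i, MemLp (fun ω => X ω i) 2 P := fun i =>
    (EuclideanSpace.proj i : Euc ι →L[ℝ] ℝ).comp_memLp' hX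
  exact (h i).integrable_mul (h j)

/-- Identifies the variance of a one-dimensional projection of a centered vector, as needed to
reduce the multivariate limit theorem to the real one. -/
lemma dotProduct_secondMoment {X : Ω → Euc ι} (hX : MemLp X 2 P) (x : Euc ι) :
    x.ofLp ⬝ᵥ secondMoment P X *ᵥ x.ofLp = ∫ ω, inner ℝ (X ω) x ^ 2 ∂P := by
  have hint := integrable_mul_coord hX
  have : ∀ ω, inner ℝ (X ω) x ^ 2 = ∑ i, ∑ j, x i * (X ω i * X ω j * x j) := fun ω => by
    rw [PiLp.inner_apply, sq, Finset.sum_mul_sum]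
    refine Finset.sum_congr rfl fun i _ => Finset.sum_congr rfl fun j _ => ?_
    simp
    ring
  simp_rw [this]
  rw [integral_finsetSum _ fun i _ => integrable_finsetSum _ fun j _ =>
    ((hint i j).mul_const _).const_mul _]
  refine Finset.sum_congr rfl fun i _ => ?_
  rw [integral_finsetSum _ fun j _ => ((hint i j).mul_const _).const_mul _]
  simp [mulVec, dotProduct, secondMoment, Finset.mul_sum, integral_const_mul, integral_mul_const]

lemma posSemidef_secondMoment {X : Ω → Euc ι} (hX : MemLp X 2 P) :
    (secondMoment P X).PosSemidef := by
  refine Matrix.PosSemidef.of_dotProduct_mulVec_nonneg ?_ fun x => ?_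
  · ext i j
    simp [secondMoment, mul_comm]
  · have := dotProduct_secondMoment hX (WithLp.toLp 2 x)
    simp only [star_trivial]
    rw [this]
    exact integral_nonneg fun _ => sq_nonneg _

/-- Multivariate central limit theorem for centered i.i.d. square integrable vectors. -/
theorem tendstoInDistribution_inv_sqrt_smul_sum [DecidableEq ι] [IsProbabilityMeasure P]
    {X : ℕ → Ω → Euc ι} (hX : MemLp (X 0) 2 P) (h0 : ∫ ω, X 0 ω ∂P = 0) (hi : iIndepFun X P)
    (hd : ∀ i, IdentDistrib (X i) (X 0) P P) :
    TendstoInDistribution (fun (n : ℕ) ω => (√(n : ℝ))⁻¹ • ∑ k ∈ Finset.range n, X k ω) atTop id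
      (fun _ => P) (multivariateGaussian 0 (secondMoment P (X 0))) where
  forall_aemeasurable n :=
    (Finset.aemeasurable_fun_sum _ fun k _ => (hd k).aemeasurable_fst).const_smul (√(n : ℝ))⁻¹
  tendsto := by
    refine ProbabilityMeasure.tendsto_iff_tendsto_charFun.2 fun t => ?_
    have hm : ∀ n : ℕ, AEMeasurable (fun ω => (√(n : ℝ))⁻¹ • ∑ k ∈ Finset.range n, X k ω) P :=
      fun n =>
        (Finset.aemeasurable_fun_sum _ fun k _ => (hd k).aemeasurable_fst).const_smul (√(n : ℝ))⁻¹
    have hmeas : Measurable fun x : Euc ι => inner ℝ x t := by fun_prop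
    have hY : MemLp (fun ω => inner ℝ (X 0 ω) t) 2 P := by
      simp_rw [real_inner_comm t]
      exact (innerSL ℝ t).comp_memLp' hX
    have hmean : ∫ ω, inner ℝ (X 0 ω) t ∂P = 0 := by
      simp_rw [real_inner_comm t]
      rw [integral_inner (hX.integrable (by norm_num)), h0, inner_zero_right]
    have hvar : Var[fun ω => inner ℝ (X 0 ω) t; P] =
        t.ofLp ⬝ᵥ secondMoment P (X 0) *ᵥ t.ofLp := by
      rw [variance_of_integral_eq_zero hY.aemeasurable hmean, dotProduct_secondMoment hX]
    have := (tendstoInDistribution_inv_sqrt_mul_sum_sub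
      (X := fun i ω => inner ℝ (X i ω) t) (Y := id) (P' := gaussianReal 0 _) HasLaw.id hY
      (hi.comp (fun _ x => inner ℝ x t) fun _ => hmeas) fun i => (hd i).comp hmeas).tendsto
    -- Cramér–Wold: the characteristic function of the vector at `t` is that of its inner product
    -- with `t` at `1`.
    have := ProbabilityMeasure.tendsto_iff_tendsto_charFun.1 this 1
    simp only [ProbabilityMeasure.coe_mk, Measure.map_id, charFun_gaussianReal, hmean, hvar] at this
    simp only [ProbabilityMeasure.coe_mk, Measure.map_id,
      charFun_multivariateGaussian (posSemidef_secondMoment hX)]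
    -- The real Gaussian takes its variance as a nonnegative real; nonnegativity undoes the
    -- truncation.
    have hnn : 0 ≤ t.ofLp ⬝ᵥ secondMoment P (X 0) *ᵥ t.ofLp := by
      rw [← hvar]; exact variance_nonneg _ _
    convert this using 2 with n
    · rw [charFun_apply, charFun_apply_real, integral_map (hm n) (by fun_prop),
        integral_map ?_ (by fun_prop)]
      · simp [inner_smul_left, sum_inner]
      · simp only [mul_zero, sub_zero]
        exact .const_mul (Finset.aemeasurable_fun_sum _ fun i _ =>
          hmeas.comp_aemeasurable (hd i).aemeasurable_fst) _
    · simp [hnn]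

/-- A sequence that converges in distribution is bounded in probability. -/
lemma exists_limsup_measure_norm_le {E Ω' : Type*} [NormedAddCommGroup E] [MeasurableSpace E]
    [BorelSpace E] [MeasurableSpace Ω'] {P' : Measure Ω'} [IsProbabilityMeasure P']
    [IsProbabilityMeasure P] {X : ℕ → Ω → E} {Z : Ω' → E}
    (h : TendstoInDistribution X atTop Z (fun _ => P) P') {ε : ENNReal} (hε : 0 < ε) :
    ∃ M : ℝ, ∀ᶠ n in atTop, P {ω | M ≤ ‖X n ω‖} < ε := by
  have hlim : Tendsto (fun M : ℕ => (P'.map Z) {x | (M : ℝ) ≤ ‖x‖}) atTop (𝓝 0) := by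
    have := Measure.isProbabilityMeasure_map h.aemeasurable_limit
    have hinter : ⋂ M : ℕ, {x : E | (M : ℝ) ≤ ‖x‖} = ∅ := by
      ext x
      simp only [Set.mem_iInter, Set.mem_ofPred_eq, Set.mem_empty_iff_false, iff_false, not_forall,
        not_le]
      exact exists_nat_gt _
    rw [← measure_empty (μ := P'.map Z), ← hinter]
    refine tendsto_measure_iInter_atTop
      (fun M => (measurableSet_le measurable_const measurable_norm).nullMeasurableSet)
      (fun m n hmn x hx => ?_) ⟨0, measure_ne_top _ _⟩
    have : (m : ℝ) ≤ n := by exact_mod_cast hmn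
    exact this.trans hx
  obtain ⟨M, hM⟩ := (hlim.eventually (gt_mem_nhds hε)).exists
  refine ⟨M, ?_⟩
  have hcl : IsClosed {x : E | (M : ℝ) ≤ ‖x‖} := isClosed_le continuous_const continuous_norm
  -- Portmanteau, applied to the closed tail set on which the limit law already has mass below `ε`.
  have := ProbabilityMeasure.limsup_measure_closed_le_of_tendsto h.tendsto hcl
  filter_upwards [eventually_lt_of_limsup_lt (this.trans_lt hM)] with n hn
  simpa [Measure.map_apply_of_aemeasurable (h.forall_aemeasurable n) hcl.measurableSet] using hn

end CentralLimit

/-- A violation would persist on a nonempty open set, which meets the dense sequence. This reduces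
uncountably many constraints to countably many, and so gives measurable sets of observations. -/
lemma forall_le_of_forall_denseSeq {X : Type*} [TopologicalSpace X]
    [TopologicalSpace.SeparableSpace X] [Nonempty X] {U : Set X} (hU : IsOpen U) {u v : X → ℝ}
    (hu : ContinuousOn u U) (hv : ContinuousOn v U)
    (h : ∀ n, TopologicalSpace.denseSeq X n ∈ U →
      u (TopologicalSpace.denseSeq X n) ≤ v (TopologicalSpace.denseSeq X n)) :
    ∀ x ∈ U, u x ≤ v x := by
  intro x hx
  by_contra! hlt
  have hopen : IsOpen (U ∩ (fun y => u y - v y) ⁻¹' Set.Ioi 0) :=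
    (hu.sub hv).isOpen_inter_preimage hU isOpen_Ioi
  obtain ⟨_, ⟨h1, h2⟩, n, rfl⟩ := (TopologicalSpace.denseRange_denseSeq X).inter_open_nonempty _
    hopen ⟨x, hx, by simpa using hlt⟩
  have := h n h1
  simp only [Set.mem_preimage, Set.mem_Ioi] at h2
  linarith

/-! ### Derivatives of random functions and the first-order remainder -/

section Derivative

variable {𝒲 : Type*} [MeasurableSpace 𝒲] {Q : Measure 𝒲} {ι κ : Type} [Fintype ι] [Fintype κ]
  {f : 𝒲 → Euc κ → Euc ι} {θ₀ : Euc κ}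

/-- A directional derivative is the almost sure limit of the difference quotients with step `1/n`.
-/
lemma aestronglyMeasurable_fderiv_apply (hf : ∀ θ, AEStronglyMeasurable (fun w => f w θ) Q)
    (hdiff : ∀ᵐ w ∂Q, DifferentiableAt ℝ (f w) θ₀) (v : Euc κ) :
    AEStronglyMeasurable (fun w => fderiv ℝ (f w) θ₀ v) Q := by
  refine aestronglyMeasurable_of_tendsto_ae atTop
    (f := fun (n : ℕ) w => (n : ℝ) • (f w (θ₀ + (n : ℝ)⁻¹ • v) - f w θ₀))
    (fun n => ((hf _).sub (hf _)).const_smul (n : ℝ)) ?_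
  filter_upwards [hdiff] with w hw
  exact hw.hasFDerivAt.lim v (c := fun n : ℕ => (n : ℝ))
    (by simpa using tendsto_natCast_atTop_atTop (R := ℝ))

lemma clm_eq_sum_smulRight [DecidableEq κ] (D : Euc κ →L[ℝ] Euc ι) :
    D = ∑ j, (EuclideanSpace.proj j : Euc κ →L[ℝ] ℝ).smulRight
      (D (EuclideanSpace.single j 1)) := by
  ext x : 1
  conv_lhs => rw [← (EuclideanSpace.basisFun κ ℝ).sum_repr x]
  simp

lemma aestronglyMeasurable_fderiv (hf : ∀ θ, AEStronglyMeasurable (fun w => f w θ) Q)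
    (hdiff : ∀ᵐ w ∂Q, DifferentiableAt ℝ (f w) θ₀) :
    AEStronglyMeasurable (fun w => fderiv ℝ (f w) θ₀) Q := by
  classical
  have : (fun w => fderiv ℝ (f w) θ₀) = fun w => ∑ j,
      (ContinuousLinearMap.smulRightL ℝ (Euc κ) (Euc ι) (EuclideanSpace.proj j))
        (fderiv ℝ (f w) θ₀ (EuclideanSpace.single j 1)) := by
    ext1 w
    exact clm_eq_sum_smulRight _
  rw [this]
  exact Finset.aestronglyMeasurable_fun_sum _ fun j _ =>
    (ContinuousLinearMap.continuous _).comp_aestronglyMeasurable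
      (aestronglyMeasurable_fderiv_apply hf hdiff _)

lemma integrable_fderiv {N : Set (Euc κ)} (hN : IsOpen N) (hθ₀ : θ₀ ∈ N)
    (hf : ∀ θ, AEStronglyMeasurable (fun w => f w θ) Q)
    (hdiff : ∀ᵐ w ∂Q, DifferentiableOn ℝ (f w) N)
    (hdom : ExpSupFinite Q N fun w θ => ‖fderiv ℝ (f w) θ‖) :
    Integrable (fun w => fderiv ℝ (f w) θ₀) Q := by
  obtain ⟨g, hg, hdom⟩ := hdom
  refine hg.mono' (aestronglyMeasurable_fderiv hf ?_) ?_
  · filter_upwards [hdiff] with w hw using hw.differentiableAt (hN.mem_nhds hθ₀)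
  · filter_upwards [hdom] with w hw using hw θ₀ hθ₀

/-- The remainder of the first order expansion at `θ₀` has, relative to `‖θ - θ₀‖`, a majorant
with small expectation. -/
lemma exists_majorant_remainder [IsProbabilityMeasure Q] {N : Set (Euc κ)} (hN : IsOpen N) (hθ₀ : θ₀ ∈ N)
    (hf : ∀ θ, AEStronglyMeasurable (fun w => f w θ) Q)
    (hdiff : ∀ᵐ w ∂Q, DifferentiableOn ℝ (f w) N)
    (hdom : ExpSupFinite Q N fun w θ => ‖fderiv ℝ (f w) θ‖)
    {η : ℝ} (hη : 0 < η) :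
    ∃ δ > 0, ∃ h : 𝒲 → ℝ, Integrable h Q ∧ ∫ w, h w ∂Q ≤ 2 * η ∧
      ∀ᵐ w ∂Q, ∀ θ ∈ Metric.ball θ₀ δ,
        ‖f w θ - f w θ₀ - fderiv ℝ (f w) θ₀ (θ - θ₀)‖ ≤ h w * ‖θ - θ₀‖ := by
  have hdiff₀ : ∀ᵐ w ∂Q, DifferentiableAt ℝ (f w) θ₀ := by
    filter_upwards [hdiff] with w hw using hw.differentiableAt (hN.mem_nhds hθ₀)
  obtain ⟨g, hg, hdom⟩ := hdom
  obtain ⟨r, hr, hrN⟩ := Metric.isOpen_iff.1 hN θ₀ hθ₀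
  let rem : 𝒲 → Euc κ → Euc ι := fun w θ => f w θ - f w θ₀ - fderiv ℝ (f w) θ₀ (θ - θ₀)
  let U : ℕ → Set (Euc κ) := fun k => Metric.ball θ₀ (r / (k + 1))
  have hUpos : ∀ k : ℕ, 0 < r / ((k : ℝ) + 1) := fun k => by positivity
  have hUr : ∀ k, U k ⊆ Metric.ball θ₀ r := fun k =>
    Metric.ball_subset_ball (div_le_self hr.le (by linarith [k.cast_nonneg (α := ℝ)]))
  have hUanti : Antitone U := fun k l hkl => Metric.ball_subset_ball (by gcongr)
  let S : ℕ → Set 𝒲 := fun k => {w | ∀ n, TopologicalSpace.denseSeq (Euc κ) n ∈ U k →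
    ‖rem w (TopologicalSpace.denseSeq (Euc κ) n)‖ ≤
      η * ‖TopologicalSpace.denseSeq (Euc κ) n - θ₀‖}
  -- The mean value inequality bounds the increment and the dominated derivative bounds the linear
  -- term, each by `|g w| * ‖θ - θ₀‖`. At `θ = θ₀` the quotient is `0 / 0 = 0`.
  have hFg : ∀ᵐ w ∂Q, ∀ k, ∀ θ ∈ U k, ‖rem w θ‖ / ‖θ - θ₀‖ ≤ 2 * |g w| := by
    filter_upwards [hdom, hdiff] with w hw hd k θ hθ
    refine div_le_of_le_mul₀ (norm_nonneg _) (by positivity) ?_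
    have h1 : ‖f w θ - f w θ₀‖ ≤ |g w| * ‖θ - θ₀‖ :=
      (convex_ball θ₀ r).norm_image_sub_le_of_norm_fderiv_le (𝕜 := ℝ)
        (fun x hx => hd.differentiableAt (hN.mem_nhds (hrN hx)))
        (fun x hx => (hw x (hrN hx)).trans (le_abs_self _)) (Metric.mem_ball_self hr) (hUr k hθ)
    have h2 : ‖fderiv ℝ (f w) θ₀ (θ - θ₀)‖ ≤ |g w| * ‖θ - θ₀‖ :=
      (ContinuousLinearMap.le_opNorm _ _).trans
        (by gcongr; exact (hw θ₀ hθ₀).trans (le_abs_self _))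
    calc ‖rem w θ‖ ≤ ‖f w θ - f w θ₀‖ + ‖fderiv ℝ (f w) θ₀ (θ - θ₀)‖ := norm_sub_le _ _
      _ ≤ 2 * |g w| * ‖θ - θ₀‖ := by linarith
  have hS : ∀ k, NullMeasurableSet (S k) Q := by
    intro k
    have : S k = ⋂ n, {w | TopologicalSpace.denseSeq (Euc κ) n ∈ U k →
        ‖rem w (TopologicalSpace.denseSeq (Euc κ) n)‖ ≤
          η * ‖TopologicalSpace.denseSeq (Euc κ) n - θ₀‖} := by
      ext w; simp [S]
    rw [this]
    refine NullMeasurableSet.iInter fun n => ?_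
    by_cases hn : TopologicalSpace.denseSeq (Euc κ) n ∈ U k
    · simp only [hn, forall_true_left]
      exact nullMeasurableSet_le (((hf _).sub (hf _)).sub
        (aestronglyMeasurable_fderiv_apply hf hdiff₀ _)).norm.aemeasurable aemeasurable_const
    · simp [hn]
  have hmono : Monotone S := by
    exact fun k l hkl w hw n hn => hw n (hUanti hkl hn)
  have hcover : ∀ᵐ w ∂Q, ∃ k, w ∈ S k := by
    filter_upwards [hdiff₀] with w hw
    have := hw.hasFDerivAt.isLittleO.def hη
    obtain ⟨ε, hε, hball⟩ := Metric.eventually_nhds_iff_ball.1 this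
    obtain ⟨k, hk⟩ := exists_nat_gt (r / ε)
    refine ⟨k, fun n hn => hball _ (Metric.ball_subset_ball ?_ hn)⟩
    rw [div_lt_iff₀ hε] at hk
    rw [div_le_iff₀ (by positivity)]
    nlinarith
  have hsmall : ∀ᵐ w ∂Q, ∀ k, w ∈ S k → ∀ θ ∈ U k, ‖rem w θ‖ / ‖θ - θ₀‖ ≤ η := by
    filter_upwards [hdiff] with w hd k hw θ hθ
    refine div_le_of_le_mul₀ (norm_nonneg _) hη.le ?_
    have hc : ContinuousOn (f w) (U k) := hd.continuousOn.mono ((hUr k).trans hrN)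
    exact forall_le_of_forall_denseSeq (U := U k) Metric.isOpen_ball
      (u := fun θ => ‖rem w θ‖) (v := fun θ => η * ‖θ - θ₀‖)
      (((hc.sub continuousOn_const).sub (by fun_prop)).norm) (by fun_prop) hw θ hθ
  obtain ⟨k, h, hint, hle, hmaj⟩ := exists_majorant_integral_le (hg.abs.const_mul 2)
    (fun w => by positivity) hFg hη hS hmono hcover hsmall
  refine ⟨r / (k + 1), hUpos k, h, hint, hle, ?_⟩
  filter_upwards [hmaj] with w hw θ hθ
  rcases eq_or_ne θ θ₀ with rfl | hne
  · simp
  · exact (div_le_iff₀ (norm_pos_iff.2 (sub_ne_zero.2 hne))).1 (hw θ hθ)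

end Derivative

/-! ### Asymptotic linearity of Z-estimators -/

section ZEstimator

variable {Ω 𝒲 : Type*} [MeasurableSpace Ω] [MeasurableSpace 𝒲] {P : Measure Ω}
  [IsProbabilityMeasure P] {W : ℕ → Ω → 𝒲} {κ : Type} [Fintype κ]
  {f : 𝒲 → Euc κ → Euc κ} {θ₀ : Euc κ} {N : Set (Euc κ)} {θhat : ℕ → Ω → Euc κ}

/-- Absorption: `u + K s = K (J u + s)` has norm at most `c * ‖u‖`, while `‖u‖ ≤ ‖u + K s‖ + ‖K‖ *
‖s‖`; since `c ≤ 1 / 2`, the first term moves to the left. -/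
lemma norm_add_le_of_expansion {E : Type*} [NormedAddCommGroup E] [NormedSpace ℝ E]
    {K J : E →L[ℝ] E} (hKJ : ∀ u, K (J u) = u) {u s : E} {ρ c : ℝ}
    (hρ : ‖J u + s‖ ≤ ρ * ‖u‖) (hc : ‖K‖ * ρ ≤ c) (hc0 : 0 ≤ c) (hc2 : c ≤ 1 / 2) :
    ‖u + K s‖ ≤ 2 * c * (‖K‖ * ‖s‖) := by
  have h1 : ‖u + K s‖ ≤ c * ‖u‖ := by
    have : u + K s = K (J u + s) := by rw [map_add, hKJ]
    rw [this]
    calc ‖K (J u + s)‖ ≤ ‖K‖ * ‖J u + s‖ := K.le_opNorm _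
      _ ≤ ‖K‖ * (ρ * ‖u‖) := by gcongr
      _ = ‖K‖ * ρ * ‖u‖ := by ring
      _ ≤ c * ‖u‖ := by gcongr
  have h2 : ‖u‖ ≤ ‖u + K s‖ + ‖K‖ * ‖s‖ := by
    have : ‖u‖ ≤ ‖u + K s‖ + ‖K s‖ := by simpa using norm_sub_le (u + K s) (K s)
    linarith [K.le_opNorm s]
  nlinarith [norm_nonneg (u + K s)]

/-- If the sum of the `a i` vanishes and `a i` is close to `b i + D i u`, then `J u` is close to
minus the average of the `b i`, for `J` close to the average of the `D i`. -/
lemma norm_add_average_le {E : Type*} [NormedAddCommGroup E] [NormedSpace ℝ E] {n : ℕ}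
    {a b : ℕ → E} {D : ℕ → E →L[ℝ] E} {h : ℕ → ℝ} {J : E →L[ℝ] E} {u : E} {η : ℝ}
    (ha : ∑ i ∈ Finset.range n, a i = 0) (hab : ∀ i, ‖a i - b i - D i u‖ ≤ h i * ‖u‖)
    (hD : ‖(n : ℝ)⁻¹ • ∑ i ∈ Finset.range n, D i - J‖ ≤ η)
    (hh : (n : ℝ)⁻¹ * ∑ i ∈ Finset.range n, h i ≤ 3 * η) :
    ‖J u + (n : ℝ)⁻¹ • ∑ i ∈ Finset.range n, b i‖ ≤ 4 * η * ‖u‖ := by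
  have hrem : ‖(n : ℝ)⁻¹ • ∑ i ∈ Finset.range n, (a i - b i - D i u)‖ ≤ 3 * η * ‖u‖ := by
    calc _ ≤ (n : ℝ)⁻¹ * ∑ i ∈ Finset.range n, h i * ‖u‖ := by
          rw [norm_smul, Real.norm_of_nonneg (by positivity)]
          gcongr
          exact (norm_sum_le _ _).trans (Finset.sum_le_sum fun i _ => hab i)
      _ = ((n : ℝ)⁻¹ * ∑ i ∈ Finset.range n, h i) * ‖u‖ := by
          rw [← Finset.sum_mul]; ring
      _ ≤ _ := by gcongr
  have hid : J u + (n : ℝ)⁻¹ • ∑ i ∈ Finset.range n, b i =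
      -(((n : ℝ)⁻¹ • ∑ i ∈ Finset.range n, D i - J) u) -
        (n : ℝ)⁻¹ • ∑ i ∈ Finset.range n, (a i - b i - D i u) := by
    simp only [Finset.sum_sub_distrib, ha, _root_.sub_apply,
      _root_.smul_apply, _root_.sum_apply, smul_sub, smul_zero]
    abel
  rw [hid]
  refine (norm_sub_le _ _).trans ?_
  rw [norm_neg]
  have := (ContinuousLinearMap.le_opNorm ((n : ℝ)⁻¹ • ∑ i ∈ Finset.range n, D i - J) u)
  have : _ ≤ η * ‖u‖ := this.trans (by gcongr)
  linarith

lemma norm_sqrt_smul_add_lt {E : Type*} [NormedAddCommGroup E] [NormedSpace ℝ E] {n : ℕ}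
    {K : E →L[ℝ] E} {u S : E} {c M ε : ℝ} (hn : 0 < n) (hc0 : 0 ≤ c)
    (h : ‖u + K ((n : ℝ)⁻¹ • S)‖ ≤ 2 * c * (‖K‖ * ‖(n : ℝ)⁻¹ • S‖))
    (hM : ‖(√(n : ℝ))⁻¹ • S‖ < M) (hcM : 2 * c * (‖K‖ * |M|) < ε) :
    ‖√(n : ℝ) • u + K ((√(n : ℝ))⁻¹ • S)‖ < ε := by
  have hn : (0 : ℝ) < n := by exact_mod_cast hn
  have hsq : √(n : ℝ) * (n : ℝ)⁻¹ = (√(n : ℝ))⁻¹ := by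
    rw [← div_eq_mul_inv, Real.sqrt_div_self']; simp
  have hid : √(n : ℝ) • u + K ((√(n : ℝ))⁻¹ • S) = √(n : ℝ) • (u + K ((n : ℝ)⁻¹ • S)) := by
    rw [smul_add, ← map_smul K (√(n : ℝ)), smul_smul, hsq]
  have hid2 : √(n : ℝ) * ‖(n : ℝ)⁻¹ • S‖ = ‖(√(n : ℝ))⁻¹ • S‖ := by
    rw [← hsq, mul_smul, norm_smul (√(n : ℝ)), Real.norm_of_nonneg (Real.sqrt_nonneg _)]
  rw [hid, norm_smul, Real.norm_of_nonneg (Real.sqrt_nonneg _)]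
  calc √(n : ℝ) * ‖u + K ((n : ℝ)⁻¹ • S)‖
      ≤ √(n : ℝ) * (2 * c * (‖K‖ * ‖(n : ℝ)⁻¹ • S‖)) := by gcongr
    _ = 2 * c * (‖K‖ * (√(n : ℝ) * ‖(n : ℝ)⁻¹ • S‖)) := by ring
    _ ≤ 2 * c * (‖K‖ * |M|) := by
        rw [hid2]
        gcongr
        exact hM.le.trans (le_abs_self _)
    _ < ε := hcM

/-- Here `k` is `‖K‖` and `M` bounds the normalized sum in probability; `c` is the absorption
constant and `η` the accuracy of the averages. Adding one in the denominators covers `k = 0` and `M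
= 0`. -/
lemma exists_small_constant {k M ε : ℝ} (hk : 0 ≤ k) (hε : 0 < ε) :
    ∃ c η : ℝ, 0 < c ∧ c ≤ 1 / 2 ∧ 2 * c * (k * |M|) < ε ∧ 0 < η ∧ k * (4 * η) ≤ c := by
  have hc : 0 < min (1 / 2) (ε / (4 * (k * |M| + 1))) := by positivity
  refine ⟨min (1 / 2) (ε / (4 * (k * |M| + 1))),
    min (1 / 2) (ε / (4 * (k * |M| + 1))) / (4 * (k + 1)), hc, min_le_left _ _, ?_,
    by positivity, ?_⟩
  · have h1 : min (1 / 2) (ε / (4 * (k * |M| + 1))) * (4 * (k * |M| + 1)) ≤ ε :=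
      (le_div_iff₀ (by positivity)).1 (min_le_right _ _)
    nlinarith [mul_nonneg hc.le (mul_nonneg hk (abs_nonneg M))]
  · rw [← mul_div_assoc, ← mul_div_assoc, div_le_iff₀ (by positivity)]
    nlinarith

/-- Accommodates tightness: the bound `M`, and with it every good event, may depend on the
probability `e` that is given up. -/
lemma withProbToOne_of_forall_exists {Ω : Type*} [MeasurableSpace Ω] {P : Measure Ω}
    {E : ℕ → Set Ω}
    (h : ∀ e : ENNReal, 0 < e → ∃ F G : ℕ → Set Ω, WithProbToOne P F ∧
      (∀ᶠ n in atTop, P (G n) < e) ∧ ∀ᶠ n in atTop, F n ∩ (G n)ᶜ ⊆ E n) :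
    WithProbToOne P E := by
  unfold WithProbToOne
  rw [ENNReal.tendsto_nhds_zero]
  intro e he
  obtain ⟨F, G, hF, hG, hE⟩ := h (e / 2) (ENNReal.half_pos he.ne')
  filter_upwards [ENNReal.tendsto_nhds_zero.1 hF (e / 2) (ENNReal.half_pos he.ne'), hG, hE]
    with n h1 h2 h3
  calc P (E n)ᶜ ≤ P ((F n)ᶜ ∪ G n) := measure_mono (by
        rw [← Set.compl_subset_compl]; simpa [Set.compl_union] using h3)
    _ ≤ P (F n)ᶜ + P (G n) := measure_union_le _ _
    _ ≤ e / 2 + e / 2 := add_le_add h1 h2.le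
    _ = e := ENNReal.add_halves e

/-- Asymptotic linearity of a consistent zero of a sum of i.i.d. smooth random functions. -/
theorem tendstoInMeasure_zEstimator_expansion (hW : ∀ i, Measurable (W i)) (hi : iIndepFun W P)
    (hd : ∀ i, IdentDistrib (W i) (W 0) P P)
    (hN : IsOpen N) (hθ₀ : θ₀ ∈ N) (hf : ∀ θ, Measurable fun w => f w θ)
    (hdiff : ∀ᵐ w ∂(P.map (W 0)), DifferentiableOn ℝ (f w) N)
    (hdom : ExpSupFinite (P.map (W 0)) N fun w θ => ‖fderiv ℝ (f w) θ‖)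
    (hmean : ∫ w, f w θ₀ ∂(P.map (W 0)) = 0) (hL2 : MemLp (fun w => f w θ₀) 2 (P.map (W 0)))
    {K : Euc κ →L[ℝ] Euc κ}
    (hK : ∀ u, K ((∫ w, fderiv ℝ (f w) θ₀ ∂(P.map (W 0))) u) = u)
    (hθhat : WithProbToOne P fun n => {ω | ∑ i ∈ Finset.range n, f (W i ω) (θhat n ω) = 0})
    (hlim : TendstoInMeasure P θhat atTop fun _ => θ₀) :
    TendstoInMeasure P (fun (n : ℕ) ω => √(n : ℝ) • (θhat n ω - θ₀) +
      K ((√(n : ℝ))⁻¹ • ∑ i ∈ Finset.range n, f (W i ω) θ₀)) atTop 0 := by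
  classical
  have : IsProbabilityMeasure (P.map (W 0)) := Measure.isProbabilityMeasure_map (hW 0).aemeasurable
  have hf' : ∀ θ, AEStronglyMeasurable (fun w => f w θ) (P.map (W 0)) :=
    fun θ => (hf θ).aestronglyMeasurable
  -- Used here only for boundedness in probability of the normalized sum at `θ₀`.
  have hclt := tendstoInDistribution_inv_sqrt_smul_sum (P := P) (X := fun i ω => f (W i ω) θ₀)
    (hL2.comp_measurePreserving ⟨hW 0, rfl⟩)
    (by rw [← hmean, integral_map (hW 0).aemeasurable (hf' θ₀)])
    (hi.comp (fun _ w => f w θ₀) fun _ => hf θ₀) fun i => (hd i).comp (hf θ₀)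
  set D : 𝒲 → Euc κ →L[ℝ] Euc κ := fun w => fderiv ℝ (f w) θ₀ with hD
  set J : Euc κ →L[ℝ] Euc κ := ∫ w, D w ∂(P.map (W 0)) with hJ
  have hDint : Integrable D (P.map (W 0)) := integrable_fderiv hN hθ₀ hf' hdiff hdom
  rw [tendstoInMeasure_iff_withProbToOne]
  intro ε hε
  refine withProbToOne_of_forall_exists fun e he => ?_
  obtain ⟨M, hM⟩ := exists_limsup_measure_norm_le hclt he
  obtain ⟨c, η, hc0, hc2, hcM, hη, hKη⟩ := exists_small_constant (M := M) (norm_nonneg K) hε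
  obtain ⟨δ, hδ, h, hint, hle, hmaj⟩ := exists_majorant_remainder hN hθ₀ hf' hdiff hdom hη
  have hE1 := tendstoInMeasure_average hW hi hd hDint
  rw [tendstoInMeasure_iff_withProbToOne] at hE1
  have hE2 := tendstoInMeasure_average hW hi hd hint
  rw [tendstoInMeasure_iff_withProbToOne] at hE2
  have hE3 := tendstoInMeasure_iff_withProbToOne.1 hlim δ hδ
  have hE4 := WithProbToOne.of_ae (E := fun _ => {ω | ∀ i, ∀ θ ∈ Metric.ball θ₀ δ,
    ‖f (W i ω) θ - f (W i ω) θ₀ - D (W i ω) (θ - θ₀)‖ ≤ h (W i ω) * ‖θ - θ₀‖})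
    ((ae_forall_of_ae_law hW hd hmaj).mono fun ω hω _ => hω)
  refine ⟨_, _, ((((hE1 η hη).inter (hE2 η hη)).inter hE3).inter hE4).inter hθhat, hM, ?_⟩
  filter_upwards [eventually_gt_atTop 0] with n hn0
  rintro ω ⟨⟨⟨⟨⟨h1, h2⟩, h3⟩, h4⟩, h5⟩, h6⟩
  simp only [Set.mem_ofPred_eq, Set.mem_compl_iff, not_le, Pi.zero_apply, sub_zero] at h1 h2 h3 h4 h5 h6 ⊢
  have hball : θhat n ω ∈ Metric.ball θ₀ δ := by rwa [Metric.mem_ball, dist_eq_norm]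
  -- The mean of `h` is at most `2 * η` and its average is within `η` of it. With the error `η` of
  -- the averaged derivative this makes the `4 * η` of `norm_add_average_le`.
  have hav : (n : ℝ)⁻¹ * ∑ i ∈ Finset.range n, h (W i ω) ≤ 3 * η := by
    have := (abs_lt.1 h2).2
    simp only [smul_eq_mul] at this
    linarith
  have hlin := norm_add_average_le (D := fun i => D (W i ω)) h5 (fun i => h4 i _ hball) h1.le hav
  have hexp := norm_add_le_of_expansion hK hlin hKη hc0.le hc2
  exact norm_sqrt_smul_add_lt hn0 hc0.le hexp h6 hcM

end ZEstimator

/-! ### Missing at random and inverse probability weighting -/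

section MissingAtRandom

variable {Ω 𝒵 : Type*} [MeasurableSpace Ω] [MeasurableSpace 𝒵] {P : Measure Ω}
  {p : ℕ} {R : ℕ → Ω → ℝ} {Z₁ : ℕ → Ω → 𝒵} {Z₂ : ℕ → Ω → ℝ}
  {π : 𝒵 → Euc (Fin p) → ℝ} {γ₀ : Euc (Fin p)}

lemma DataModel.measurable_obs (hdata : DataModel P R Z₁ Z₂ π γ₀) (i : ℕ) :
    Measurable fun ω => (R i ω, Z₁ i ω, Z₂ i ω) :=
  (hdata.measurable_R i).prodMk ((hdata.measurable_Z₁ i).prodMk (hdata.measurable_Z₂ i))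

lemma DataModel.isProbabilityMeasure_obsLaw [IsProbabilityMeasure P]
    (hdata : DataModel P R Z₁ Z₂ π γ₀) :
    IsProbabilityMeasure (obsLaw P R Z₁ Z₂) :=
  Measure.isProbabilityMeasure_map (hdata.measurable_obs 0).aemeasurable

lemma DataModel.ae_obsLaw (hdata : DataModel P R Z₁ Z₂ π γ₀) :
    ∀ᵐ w ∂(obsLaw P R Z₁ Z₂), 0 ≤ w.1 ∧ 0 < π w.2.1 γ₀ := by
  have hπ : Measurable fun w : Obs 𝒵 => π w.2.1 γ₀ :=
    (hdata.measurable_π γ₀).comp (measurable_fst.comp measurable_snd)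
  refine (ae_map_iff (hdata.measurable_obs 0).aemeasurable
    ((measurableSet_le measurable_const measurable_fst).inter
      (measurableSet_lt measurable_const hπ))).2 ?_
  filter_upwards [hdata.positivity] with ω hω
  refine ⟨?_, hω⟩
  rcases hdata.binary 0 ω with h | h <;> simp [h]

variable [IsProbabilityMeasure P]

/-- Since `E[R | Z₁, Z₂] = π(Z₁; γ₀)`, the densities `R` and `π(Z₁; γ₀)` give equal mass to every
event generated by `(Z₁, Z₂)`, hence induce the same measure on its values. -/
lemma DataModel.lintegral_R_mul (hdata : DataModel P R Z₁ Z₂ π γ₀) {k : 𝒵 × ℝ → ENNReal}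
    (hk : Measurable k) :
    ∫⁻ ω, ENNReal.ofReal (R 0 ω) * k (Z₁ 0 ω, Z₂ 0 ω) ∂P =
      ∫⁻ ω, ENNReal.ofReal (π (Z₁ 0 ω) γ₀) * k (Z₁ 0 ω, Z₂ 0 ω) ∂P := by
  have hR := hdata.measurable_R 0
  have hZ : Measurable fun ω => (Z₁ 0 ω, Z₂ 0 ω) :=
    (hdata.measurable_Z₁ 0).prodMk (hdata.measurable_Z₂ 0)
  have hπ : Measurable fun ω => π (Z₁ 0 ω) γ₀ := (hdata.measurable_π γ₀).comp (hdata.measurable_Z₁ 0)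
  have hR0 : ∀ ω, 0 ≤ R 0 ω := fun ω => by rcases hdata.binary 0 ω with h | h <;> simp [h]
  have hRint : Integrable (R 0) P := by
    refine Integrable.of_bound hR.aestronglyMeasurable 1 (.of_forall fun ω => ?_)
    rcases hdata.binary 0 ω with h | h <;> simp [h]
  have hcond := hdata.missingAtRandom.trans hdata.correctlySpecified
  have hπint : Integrable (fun ω => π (Z₁ 0 ω) γ₀) P := integrable_condExp.congr hcond
  have hmeas : (P.withDensity fun ω => ENNReal.ofReal (R 0 ω)).map (fun ω => (Z₁ 0 ω, Z₂ 0 ω)) =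
      (P.withDensity fun ω => ENNReal.ofReal (π (Z₁ 0 ω) γ₀)).map
        (fun ω => (Z₁ 0 ω, Z₂ 0 ω)) := by
    ext S hS
    rw [Measure.map_apply hZ hS, Measure.map_apply hZ hS, withDensity_apply _ (hZ hS),
      withDensity_apply _ (hZ hS), ← ofReal_integral_eq_lintegral_ofReal hRint.integrableOn
        (.of_forall hR0), ← ofReal_integral_eq_lintegral_ofReal hπint.integrableOn
        (ae_restrict_of_ae (hdata.positivity.mono fun _ h => h.le)),
      ← setIntegral_condExp hZ.comap_le hRint ⟨S, hS, rfl⟩]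
    congr 1
    exact integral_congr_ae (ae_restrict_of_ae hcond)
  have := congrArg (fun μ => ∫⁻ z, k z ∂μ) hmeas
  simp only [lintegral_map hk hZ] at this
  have hkZ : Measurable fun ω => k (Z₁ 0 ω, Z₂ 0 ω) := hk.comp hZ
  rwa [lintegral_withDensity_eq_lintegral_mul _ hR.ennreal_ofReal hkZ,
    lintegral_withDensity_eq_lintegral_mul _ hπ.ennreal_ofReal hkZ] at this

/-- Inverse probability weighting recovers the law of `(Z₁, Z₂)`. -/
lemma DataModel.map_withDensity_obsLaw (hdata : DataModel P R Z₁ Z₂ π γ₀) :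
    ((obsLaw P R Z₁ Z₂).withDensity fun w => ENNReal.ofReal (w.1 / π w.2.1 γ₀)).map Prod.snd =
      (obsLaw P R Z₁ Z₂).map Prod.snd := by
  have hπ : Measurable fun w : Obs 𝒵 => π w.2.1 γ₀ :=
    (hdata.measurable_π γ₀).comp (measurable_fst.comp measurable_snd)
  have hπ' : Measurable fun z : 𝒵 × ℝ => π z.1 γ₀ := (hdata.measurable_π γ₀).comp measurable_fst
  have hρ : Measurable fun w : Obs 𝒵 => ENNReal.ofReal (w.1 / π w.2.1 γ₀) :=
    (measurable_fst.div hπ).ennreal_ofReal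
  ext S hS
  have hS' : MeasurableSet (Prod.snd ⁻¹' S : Set (Obs 𝒵)) := measurable_snd hS
  have h1 : Measurable (S.indicator (1 : 𝒵 × ℝ → ENNReal)) := measurable_one.indicator hS
  rw [Measure.map_apply measurable_snd hS, Measure.map_apply measurable_snd hS,
    withDensity_apply _ hS', ← lintegral_indicator hS', ← lintegral_indicator_one hS',
    obsLaw, lintegral_map (hρ.indicator hS') (hdata.measurable_obs 0),
    lintegral_map (measurable_one.indicator hS') (hdata.measurable_obs 0)]
  -- The test function is the indicator of `S` divided by `π`, so that `π` cancels on the right.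
  have := hdata.lintegral_R_mul
    (k := fun z => (ENNReal.ofReal (π z.1 γ₀))⁻¹ * S.indicator 1 z)
    (hπ'.ennreal_ofReal.inv.mul h1)
  calc _ = ∫⁻ ω, ENNReal.ofReal (R 0 ω) * ((ENNReal.ofReal (π (Z₁ 0 ω) γ₀))⁻¹ *
          S.indicator 1 (Z₁ 0 ω, Z₂ 0 ω)) ∂P := by
        refine lintegral_congr_ae ?_
        filter_upwards [hdata.positivity] with ω hω
        by_cases hmem : (Z₁ 0 ω, Z₂ 0 ω) ∈ S
        · simp [Set.indicator, hmem, ENNReal.ofReal_div_of_pos hω, ← div_eq_mul_inv]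
        · simp [Set.indicator, hmem]
    _ = _ := this
    _ = _ := by
        refine lintegral_congr_ae ?_
        filter_upwards [hdata.positivity] with ω hω
        rw [← mul_assoc, ENNReal.mul_inv_cancel (by simpa using hω) (by simp), one_mul]
        rfl

/-- Inverse probability weighting does not change expectations of functions of `(Z₁, Z₂)`. -/
lemma DataModel.integral_weight_smul (hdata : DataModel P R Z₁ Z₂ π γ₀) {E : Type*}
    [NormedAddCommGroup E] [NormedSpace ℝ E] {h : 𝒵 × ℝ → E} (hh : StronglyMeasurable h) :
    ∫ w, (w.1 / π w.2.1 γ₀) • h w.2 ∂(obsLaw P R Z₁ Z₂) = ∫ w, h w.2 ∂(obsLaw P R Z₁ Z₂) := by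
  have hπ : Measurable fun w : Obs 𝒵 => π w.2.1 γ₀ :=
    (hdata.measurable_π γ₀).comp (measurable_fst.comp measurable_snd)
  have hρ : Measurable fun w : Obs 𝒵 => ENNReal.ofReal (w.1 / π w.2.1 γ₀) :=
    (measurable_fst.div hπ).ennreal_ofReal
  -- Equal measures give equal Bochner integrals, so integrability of `h` is not needed.
  have := congrArg (fun μ => ∫ z, h z ∂μ) hdata.map_withDensity_obsLaw
  rw [integral_map measurable_snd.aemeasurable hh.aestronglyMeasurable,
    integral_map measurable_snd.aemeasurable hh.aestronglyMeasurable,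
    integral_withDensity_eq_integral_toReal_smul hρ
      (.of_forall fun _ => ENNReal.ofReal_lt_top)] at this
  rw [← this]
  refine integral_congr_ae ?_
  filter_upwards [hdata.ae_obsLaw] with w hw
  rw [ENNReal.toReal_ofReal (div_nonneg hw.1 hw.2.le)]

end MissingAtRandom

/-! ### The location-scale estimating function -/

section EstimatingFunction

variable (ψμ ψσ : ℝ → ℝ) (A B : ℝ)

/-- Shifting the outcome amounts to shifting the location parameter. -/
lemma mPsi_eq_shift (z : ℝ) (β : Euc (Fin 2)) :
    mPsi ψμ ψσ A B z β = mPsi ψμ ψσ A B 0 (β - EuclideanSpace.single 0 z) := by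
  simp [mPsi]

/-- Writes the derivative at a varying outcome as the derivative of one fixed function at a moving
point, which makes it measurable in the outcome. -/
lemma fderiv_mPsi_eq_shift (z : ℝ) (β : Euc (Fin 2)) :
    fderiv ℝ (mPsi ψμ ψσ A B z) β =
      fderiv ℝ (mPsi ψμ ψσ A B 0) (β - EuclideanSpace.single 0 z) := by
  rw [← fderiv_comp_sub]
  congr 1
  ext1 b
  exact mPsi_eq_shift ψμ ψσ A B z b

variable {ψμ ψσ}

lemma measurable_mPsi (hψμ : Measurable ψμ) (hψσ : Measurable ψσ) (β : Euc (Fin 2)) :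
    Measurable fun z => mPsi ψμ ψσ A B z β := by
  unfold mPsi
  refine (PiLp.continuous_toLp 2 _).measurable.comp (measurable_pi_lambda _ fun i => ?_)
  fin_cases i
  · exact (hψμ.comp (by fun_prop)).sub_const A
  · exact ((hψσ.comp (by fun_prop)).pow_const 2).sub_const B

lemma measurable_phi {𝒵 : Type*} [MeasurableSpace 𝒵] {p : ℕ} {π : 𝒵 → Euc (Fin p) → ℝ}
    (hψμ : Measurable ψμ) (hψσ : Measurable ψσ) (hπ : ∀ γ, Measurable fun z => π z γ)
    (β : Euc (Fin 2)) (γ : Euc (Fin p)) :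
    Measurable fun w : Obs 𝒵 => phi ψμ ψσ A B π w β γ :=
  (measurable_fst.div ((hπ γ).comp (measurable_fst.comp measurable_snd))).smul
    ((measurable_mPsi A B hψμ hψσ β).comp (measurable_snd.comp measurable_snd))

lemma continuousAt_mPsi {z : ℝ} {β : Euc (Fin 2)}
    (hμ : ContinuousAt (fun b : Euc (Fin 2) => ψμ ((z - b 0) / b 1)) β)
    (hσ : ContinuousAt (fun b : Euc (Fin 2) => ψσ ((z - b 0) / b 1)) β) :
    ContinuousAt (mPsi ψμ ψσ A B z) β := by
  unfold mPsi
  refine (PiLp.continuous_toLp 2 _).continuousAt.comp (continuousAt_pi.2 fun i => ?_)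
  fin_cases i
  · exact hμ.sub_const A
  · exact (hσ.pow 2).sub_const B

end EstimatingFunction

/-- A zero of a sum of i.i.d. random functions stays away from a region on which these functions
are, on average, closer to their value at `x₀` than the expectation of the latter is to zero. -/
lemma withProbToOne_notMem_of_majorant {Ω 𝒲 α : Type*} [MeasurableSpace Ω] [MeasurableSpace 𝒲]
    {P : Measure Ω} [IsProbabilityMeasure P] {W : ℕ → Ω → 𝒲} {κ : Type} [Fintype κ]
    {f : 𝒲 → α → Euc κ} {x₀ : α} {U : Set α} {h : 𝒲 → ℝ} {xhat : ℕ → Ω → α}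
    (hW : ∀ i, Measurable (W i)) (hi : iIndepFun W P) (hd : ∀ i, IdentDistrib (W i) (W 0) P P)
    (hf : Integrable (fun w => f w x₀) (P.map (W 0))) (hh : Integrable h (P.map (W 0)))
    (hmaj : ∀ᵐ w ∂(P.map (W 0)), ∀ x ∈ U, ‖f w x - f w x₀‖ ≤ h w)
    (hlt : ∫ w, h w ∂(P.map (W 0)) < ‖∫ w, f w x₀ ∂(P.map (W 0))‖)
    (hxhat : WithProbToOne P fun n => {ω | ∑ i ∈ Finset.range n, f (W i ω) (xhat n ω) = 0}) :
    WithProbToOne P fun n => {ω | xhat n ω ∉ U} := by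
  set v := ∫ w, f w x₀ ∂(P.map (W 0))
  set c := ∫ w, h w ∂(P.map (W 0))
  have hη : 0 < (‖v‖ - c) / 2 := by linarith
  have h1 := tendstoInMeasure_average hW hi hd hf
  rw [tendstoInMeasure_iff_withProbToOne] at h1
  have h2 := tendstoInMeasure_average hW hi hd hh
  rw [tendstoInMeasure_iff_withProbToOne] at h2
  have h3 := WithProbToOne.of_ae (E := fun _ => {ω | ∀ i, ∀ x ∈ U,
    ‖f (W i ω) x - f (W i ω) x₀‖ ≤ h (W i ω)})
    ((ae_forall_of_ae_law hW hd hmaj).mono fun ω hω _ => hω)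
  refine ((((h1 _ hη).inter (h2 _ hη)).inter h3).inter hxhat).mono (.of_forall fun n => ?_)
  rintro ω ⟨⟨⟨e1, e2⟩, e3⟩, e4⟩ hU
  simp only [Set.mem_ofPred_eq] at e1 e2 e3 e4
  have hav : ‖(n : ℝ)⁻¹ • ∑ i ∈ Finset.range n, f (W i ω) x₀‖ ≤
      (n : ℝ)⁻¹ • ∑ i ∈ Finset.range n, h (W i ω) := by
    -- The sum vanishes at `xhat`, so the sum at `x₀` consists of increments, which `h` controls if
    -- `xhat` lies in `U`.
    have : ∑ i ∈ Finset.range n, f (W i ω) x₀ =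
        -∑ i ∈ Finset.range n, (f (W i ω) (xhat n ω) - f (W i ω) x₀) := by
      simp [Finset.sum_sub_distrib, e4]
    rw [this, norm_smul, norm_neg, Real.norm_of_nonneg (by positivity), smul_eq_mul]
    gcongr
    exact (norm_sum_le _ _).trans (Finset.sum_le_sum fun i _ => e3 i _ hU)
  have h5 := (abs_lt.1 e2).2
  have h6 := norm_sub_norm_le v ((n : ℝ)⁻¹ • ∑ i ∈ Finset.range n, f (W i ω) x₀)
  rw [norm_sub_rev] at h6
  linarith

/-! ### Local majorants for the weighted estimating function -/

section Consistency

variable {𝒵 : Type*} [MeasurableSpace 𝒵] {Q : Measure (Obs 𝒵)} {p : ℕ}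
  {ψμ ψσ : ℝ → ℝ} {A B : ℝ} {π : 𝒵 → Euc (Fin p) → ℝ} {ℬ : Set (Euc (Fin 2))}
  {β₀ : Euc (Fin 2)} {γ₀ : Euc (Fin p)}

/-- For fixed `c` and `c'` the constraint is closed: membership of the center in an open ball
implies a closed condition on the scalars. Closed sets survive uncountable intersections, so `m` may
be arbitrary. Quantifying over two points avoids evaluating `m` at the moving center. -/
lemma isClosed_forall_ball_norm_sub_le {E F : Type*} [NormedAddCommGroup E] [NormedAddCommGroup F]
    [NormedSpace ℝ F] (m : E → F) (δ η : ℝ) :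
    IsClosed {x : (ℝ × ℝ) × E | ∀ c ∈ Metric.ball x.2 δ, ∀ c' ∈ Metric.ball x.2 δ,
      ‖x.1.1 • m c - x.1.2 • m c'‖ ≤ η} := by
  have : {x : (ℝ × ℝ) × E | ∀ c ∈ Metric.ball x.2 δ, ∀ c' ∈ Metric.ball x.2 δ,
      ‖x.1.1 • m c - x.1.2 • m c'‖ ≤ η} = ⋂ c, ⋂ c', {x | x.2 ∈ Metric.ball c δ →
        x.2 ∈ Metric.ball c' δ → ‖x.1.1 • m c - x.1.2 • m c'‖ ≤ η} := by
    ext x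
    simp only [Set.mem_iInter, Set.mem_ofPred_eq, Metric.mem_ball, dist_comm x.2]
    exact forall_congr' fun c => ⟨fun h c' hc hc' => h hc c' hc', fun h hc c' hc' => h c' hc hc'⟩
  rw [this]
  refine isClosed_iInter fun c => isClosed_iInter fun c' => ?_
  refine isClosed_imp (Metric.isOpen_ball.preimage continuous_snd)
    (isClosed_imp (Metric.isOpen_ball.preimage continuous_snd) (isClosed_le ?_ continuous_const))
  fun_prop

/-- By the location shift, nearness of `b` to `β` at outcome `z₂` is nearness to the shifted center
for the single function `m₀`. Small oscillation is then a closed condition on the center and the two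
weights, which are measurable in `w`; the parameter `γ` is handled along a dense sequence. -/
lemma exists_majorant_phi [IsProbabilityMeasure Q] (hπ : ∀ γ, Measurable fun z => π z γ)
    (hcons : ConsistencyConditions Q ψμ ψσ A B π ℬ β₀ γ₀) {β : Euc (Fin 2)} (hβ : β ∈ ℬ)
    {η : ℝ} (hη : 0 < η) :
    ∃ δ > 0, ∃ h : Obs 𝒵 → ℝ, Integrable h Q ∧ ∫ w, h w ∂Q ≤ 2 * η ∧
      ∀ᵐ w ∂Q, ∀ x ∈ (Metric.ball β δ ∩ ℬ) ×ˢ Metric.ball γ₀ δ,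
        ‖phi ψμ ψσ A B π w x.1 x.2 - phi ψμ ψσ A B π w β γ₀‖ ≤ h w := by
  obtain ⟨G, hG, hγ₀G, hsmooth, g, hg, hdom⟩ := hcons.smooth_π
  obtain ⟨ε, hε, hover⟩ := hcons.overlap
  obtain ⟨r, hr, hrG⟩ := Metric.isOpen_iff.1 hG γ₀ hγ₀G
  let d := TopologicalSpace.denseSeq (Euc (Fin p))
  let m₀ := mPsi ψμ ψσ A B 0
  let shift : Obs 𝒵 → Euc (Fin 2) := fun w => β - EuclideanSpace.single 0 w.2.2
  let rad : ℕ → ℝ := fun k => r / (k + 1)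
  have hrad : ∀ k : ℕ, 0 < rad k := fun k => by positivity
  have hradr : ∀ k, rad k ≤ r := fun k =>
    div_le_self hr.le (by linarith [k.cast_nonneg (α := ℝ)])
  have hanti : Antitone rad := fun k l hkl => by dsimp only [rad]; gcongr
  -- The lower bound `ε / 2` keeps the weight continuous in `γ` on the ball, so that the oscillation
  -- bound passes from the dense points to all of it.
  let S : ℕ → Set (Obs 𝒵) := fun k => {w | ∀ n, d n ∈ Metric.ball γ₀ (rad k) →
    ε / 2 ≤ π w.2.1 (d n) ∧ ∀ c ∈ Metric.ball (shift w) (rad k),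
      ∀ c' ∈ Metric.ball (shift w) (rad k),
        ‖(w.1 / π w.2.1 (d n)) • m₀ c - (w.1 / π w.2.1 γ₀) • m₀ c'‖ ≤ η}
  have hφ : ∀ w b γ, phi ψμ ψσ A B π w b γ =
      (w.1 / π w.2.1 γ) • m₀ (b - EuclideanSpace.single 0 w.2.2) := fun w b γ => by
    rw [phi, mPsi_eq_shift]
  have hFg : ∀ᵐ w ∂Q, ∀ k, ∀ x ∈ (Metric.ball β (rad k) ∩ ℬ) ×ˢ Metric.ball γ₀ (rad k),
      ‖phi ψμ ψσ A B π w x.1 x.2 - phi ψμ ψσ A B π w β γ₀‖ ≤ 2 * |g w| := by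
    filter_upwards [hdom] with w hw k x hx
    have h1 := hw x ⟨hx.1.2, hrG (Metric.ball_subset_ball (hradr k) hx.2)⟩
    have h2 := hw (β, γ₀) ⟨hβ, hγ₀G⟩
    refine (norm_sub_le _ _).trans ?_
    have := le_abs_self (g w)
    simp only at h1 h2
    linarith
  have hS : ∀ k, NullMeasurableSet (S k) Q := by
    intro k
    have hπ' : ∀ γ, Measurable fun w : Obs 𝒵 => π w.2.1 γ := fun γ =>
      (hπ γ).comp (measurable_fst.comp measurable_snd)
    have hshift : Measurable shift := by
      refine measurable_const.sub ?_
      have : Continuous fun z : ℝ => EuclideanSpace.single (0 : Fin 2) z :=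
        (PiLp.continuous_toLp 2 fun _ : Fin 2 => ℝ).comp
          (continuous_single (A := fun _ : Fin 2 => ℝ) 0)
      exact this.measurable.comp (measurable_snd.comp measurable_snd)
    have : S k = ⋂ n, {w | d n ∈ Metric.ball γ₀ (rad k) →
        ε / 2 ≤ π w.2.1 (d n) ∧ ∀ c ∈ Metric.ball (shift w) (rad k),
          ∀ c' ∈ Metric.ball (shift w) (rad k),
            ‖(w.1 / π w.2.1 (d n)) • m₀ c - (w.1 / π w.2.1 γ₀) • m₀ c'‖ ≤ η} := by
      ext w; simp [S]
    rw [this]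
    refine (MeasurableSet.iInter fun n => ?_).nullMeasurableSet
    by_cases hn : d n ∈ Metric.ball γ₀ (rad k)
    · simp only [hn, forall_true_left]
      refine (measurableSet_le measurable_const (hπ' _)).inter ?_
      exact (((measurable_fst.div (hπ' (d n))).prodMk (measurable_fst.div (hπ' γ₀))).prodMk hshift)
        (isClosed_forall_ball_norm_sub_le m₀ (rad k) η).measurableSet
    · simp [hn]
  have hmono : Monotone S := by
    intro k l hkl w hw n hn
    have hsub := Metric.ball_subset_ball (x := shift w) (hanti hkl)
    obtain ⟨h1, h2⟩ := hw n (Metric.ball_subset_ball (hanti hkl) hn)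
    exact ⟨h1, fun c hc c' hc' => h2 c (hsub hc) c' (hsub hc')⟩
  have hcover : ∀ᵐ w ∂Q, ∃ k, w ∈ S k := by
    filter_upwards [hcons.continuous_ψ β hβ, hover, hsmooth] with w hψ hw hsm
    have hπc : ContinuousAt (π w.2.1) γ₀ := hsm.continuousOn.continuousAt (hG.mem_nhds hγ₀G)
    have hπ0 : π w.2.1 γ₀ ≠ 0 := (hε.trans hw.1).ne'
    have hm : ContinuousAt m₀ (shift w) := by
      have h1 := continuousAt_mPsi A B hψ.1 hψ.2
      have h2 : m₀ = fun c => mPsi ψμ ψσ A B w.2.2 (c + EuclideanSpace.single 0 w.2.2) := by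
        ext1 c
        rw [mPsi_eq_shift _ _ _ _ w.2.2, add_sub_cancel_right]
      rw [h2]
      exact ContinuousAt.comp_of_eq (g := mPsi ψμ ψσ A B w.2.2) h1
        (f := fun c : Euc (Fin 2) => c + EuclideanSpace.single 0 w.2.2)
        (continuousAt_id.add continuousAt_const) (by simp [shift])
    have hcont : ContinuousAt (fun x : Euc (Fin p) × Euc (Fin 2) × Euc (Fin 2) =>
        (w.1 / π w.2.1 x.1) • m₀ x.2.1 - (w.1 / π w.2.1 γ₀) • m₀ x.2.2)
        (γ₀, shift w, shift w) := by
      refine ContinuousAt.sub (ContinuousAt.smul (ContinuousAt.div continuousAt_const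
        (g := fun x : Euc (Fin p) × Euc (Fin 2) × Euc (Fin 2) => π w.2.1 x.1) ?_ hπ0) ?_)
        (ContinuousAt.smul (f := fun _ => w.1 / π w.2.1 γ₀) continuousAt_const ?_)
      · exact ContinuousAt.comp (f := Prod.fst) hπc continuousAt_fst
      · exact ContinuousAt.comp_of_eq hm (x := (γ₀, shift w, shift w))
          (f := fun x : Euc (Fin p) × Euc (Fin 2) × Euc (Fin 2) => x.2.1) (by fun_prop) rfl
      · exact ContinuousAt.comp_of_eq hm (x := (γ₀, shift w, shift w))
          (f := fun x : Euc (Fin p) × Euc (Fin 2) × Euc (Fin 2) => x.2.2) (by fun_prop) rfl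
    have hev1 : ∀ᶠ x : Euc (Fin p) × Euc (Fin 2) × Euc (Fin 2) in 𝓝 (γ₀, shift w, shift w),
        ‖(w.1 / π w.2.1 x.1) • m₀ x.2.1 - (w.1 / π w.2.1 γ₀) • m₀ x.2.2‖ < η :=
      hcont.norm.eventually (gt_mem_nhds (by simpa using hη))
    have hev2 : ∀ᶠ x : Euc (Fin p) × Euc (Fin 2) × Euc (Fin 2) in 𝓝 (γ₀, shift w, shift w),
        ε / 2 < π w.2.1 x.1 :=
      (ContinuousAt.comp (f := Prod.fst) hπc continuousAt_fst).eventually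
        (lt_mem_nhds (show ε / 2 < π w.2.1 γ₀ by linarith [hw.1]))
    obtain ⟨δ, hδ, hball⟩ := Metric.eventually_nhds_iff_ball.1 (hev1.and hev2)
    obtain ⟨k, hk⟩ := exists_nat_gt (r / δ)
    have hkδ : rad k ≤ δ := by
      rw [div_lt_iff₀ hδ] at hk
      rw [div_le_iff₀ (by positivity)]
      nlinarith
    have key : ∀ γ ∈ Metric.ball γ₀ (rad k), ∀ c ∈ Metric.ball (shift w) (rad k),
        ∀ c' ∈ Metric.ball (shift w) (rad k), (γ, c, c') ∈ Metric.ball (γ₀, shift w, shift w) δ := by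
      intro γ hγ c hc c' hc'
      rw [← ball_prod_same, ← ball_prod_same]
      exact ⟨Metric.ball_subset_ball hkδ hγ, Metric.ball_subset_ball hkδ hc,
        Metric.ball_subset_ball hkδ hc'⟩
    have hself := Metric.mem_ball_self (x := shift w) (hrad k)
    exact ⟨k, fun n hn => ⟨(hball _ (key _ hn _ hself _ hself)).2.le,
      fun c hc c' hc' => (hball _ (key _ hn c hc c' hc')).1.le⟩⟩
  have hsmall : ∀ᵐ w ∂Q, ∀ k, w ∈ S k →
      ∀ x ∈ (Metric.ball β (rad k) ∩ ℬ) ×ˢ Metric.ball γ₀ (rad k),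
        ‖phi ψμ ψσ A B π w x.1 x.2 - phi ψμ ψσ A B π w β γ₀‖ ≤ η := by
    filter_upwards [hsmooth] with w hsm k hw x hx
    have hπc : ContinuousOn (π w.2.1) (Metric.ball γ₀ (rad k)) :=
      hsm.continuousOn.mono ((Metric.ball_subset_ball (hradr k)).trans hrG)
    have hlow : ∀ γ ∈ Metric.ball γ₀ (rad k), ε / 2 ≤ π w.2.1 γ :=
      forall_le_of_forall_denseSeq Metric.isOpen_ball continuousOn_const hπc
        fun n hn => (hw n hn).1
    rw [hφ, hφ]
    refine forall_le_of_forall_denseSeq (U := Metric.ball γ₀ (rad k)) Metric.isOpen_ball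
      (u := fun γ => ‖(w.1 / π w.2.1 γ) • m₀ (x.1 - EuclideanSpace.single 0 w.2.2) -
        (w.1 / π w.2.1 γ₀) • m₀ (β - EuclideanSpace.single 0 w.2.2)‖) (v := fun _ => η)
      ?_ continuousOn_const (fun n hn => (hw n hn).2 _ ?_ _ (Metric.mem_ball_self (hrad k)))
      x.2 hx.2
    · refine ContinuousOn.norm (ContinuousOn.sub (ContinuousOn.smul
        (continuousOn_const.div hπc fun γ hγ => ?_) continuousOn_const) continuousOn_const)
      exact ((half_pos hε).trans_le (hlow γ hγ)).ne'
    · simpa [shift, Metric.mem_ball, dist_eq_norm] using hx.1.1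
  obtain ⟨k, h, hint, hle, hmaj⟩ := exists_majorant_integral_le (hg.abs.const_mul 2)
    (fun w => by positivity) hFg hη hS hmono hcover hsmall
  exact ⟨rad k, hrad k, h, hint, hle, hmaj⟩

end Consistency

/-! ### Consistency by compactness -/

section ConsistencyTheorem

variable {Ω 𝒵 : Type*} [MeasurableSpace Ω] [MeasurableSpace 𝒵] {P : Measure Ω}
  [IsProbabilityMeasure P] {p : ℕ} {R : ℕ → Ω → ℝ} {Z₁ : ℕ → Ω → 𝒵} {Z₂ : ℕ → Ω → ℝ}
  {π : 𝒵 → Euc (Fin p) → ℝ} {γ₀ : Euc (Fin p)} {ℬ : Set (Euc (Fin 2))} {β₀ : Euc (Fin 2)}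
  {ψμ ψσ : ℝ → ℝ} {A B : ℝ} {γhat : ℕ → Ω → Euc (Fin p)} {βhat : ℕ → Ω → Euc (Fin 2)}

theorem tendstoInMeasure_betahat (hdata : DataModel P R Z₁ Z₂ π γ₀)
    (hψμ : Measurable ψμ) (hψσ : Measurable ψσ)
    (hγhat_lim : TendstoInMeasure P γhat atTop fun _ => γ₀)
    (hβhat : WithProbToOne P fun n => {ω | βhat n ω ∈ ℬ ∧
      ∑ i ∈ Finset.range n,
        phi ψμ ψσ A B π (R i ω, Z₁ i ω, Z₂ i ω) (βhat n ω) (γhat n ω) = 0})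
    (hcons : ConsistencyConditions (obsLaw P R Z₁ Z₂) ψμ ψσ A B π ℬ β₀ γ₀) :
    TendstoInMeasure P βhat atTop fun _ => β₀ := by
  have hQ := hdata.isProbabilityMeasure_obsLaw
  have hzero : WithProbToOne P fun n => {ω | ∑ i ∈ Finset.range n,
      phi ψμ ψσ A B π (R i ω, Z₁ i ω, Z₂ i ω) (βhat n ω) (γhat n ω) = 0} :=
    hβhat.mono (.of_forall fun n ω hω => hω.2)
  have hloc : ∀ β ∈ ℬ, β ≠ β₀ → ∃ δ > 0, WithProbToOne P fun n =>
      {ω | βhat n ω ∉ Metric.ball β δ} := by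
    intro β hβ hne
    have hmean : ∫ w, phi ψμ ψσ A B π w β γ₀ ∂(obsLaw P R Z₁ Z₂) =
        ∫ w, mPsi ψμ ψσ A B w.2.2 β ∂(obsLaw P R Z₁ Z₂) :=
      hdata.integral_weight_smul (h := fun z => mPsi ψμ ψσ A B z.2 β)
        ((measurable_mPsi A B hψμ hψσ β).comp measurable_snd).stronglyMeasurable
    have hv : 0 < ‖∫ w, phi ψμ ψσ A B π w β γ₀ ∂(obsLaw P R Z₁ Z₂)‖ := by
      rw [hmean]
      exact norm_pos_iff.2 fun h => hne (hcons.identification β hβ h)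
    have hφint : Integrable (fun w => phi ψμ ψσ A B π w β γ₀) (obsLaw P R Z₁ Z₂) := by
      obtain ⟨G, hG, hγ₀G, -, g, hg, hdom⟩ := hcons.smooth_π
      refine hg.mono' (measurable_phi A B hψμ hψσ hdata.measurable_π β γ₀).aestronglyMeasurable ?_
      filter_upwards [hdom] with w hw using hw (β, γ₀) ⟨hβ, hγ₀G⟩
    -- With `η` a quarter of the norm of the mean, the majorant has mean at most half of that norm.
    obtain ⟨δ, hδ, h, hint, hle, hmaj⟩ := exists_majorant_phi hdata.measurable_π hcons hβ
      (div_pos hv (by norm_num : (0 : ℝ) < 4))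
    refine ⟨δ, hδ, ?_⟩
    have hlt : ∫ w, h w ∂(obsLaw P R Z₁ Z₂) <
        ‖∫ w, phi ψμ ψσ A B π w β γ₀ ∂(obsLaw P R Z₁ Z₂)‖ := by linarith
    have hout := withProbToOne_notMem_of_majorant (P := P)
      (W := fun i ω => (R i ω, Z₁ i ω, Z₂ i ω)) (f := fun w x => phi ψμ ψσ A B π w x.1 x.2)
      (x₀ := (β, γ₀)) (U := (Metric.ball β δ ∩ ℬ) ×ˢ Metric.ball γ₀ δ) (h := h)
      (xhat := fun n ω => (βhat n ω, γhat n ω))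
      hdata.measurable_obs hdata.indep hdata.identDistrib hφint hint hmaj
      hlt hzero
    have hγ := tendstoInMeasure_iff_withProbToOne.1 hγhat_lim δ hδ
    refine ((hout.inter hγ).inter hβhat).mono (.of_forall fun n => ?_)
    rintro ω ⟨⟨h1, h2⟩, h3⟩ hmem
    exact h1 ⟨⟨hmem, h3.1⟩, by rw [Metric.mem_ball, dist_eq_norm]; exact h2⟩
  rw [tendstoInMeasure_iff_withProbToOne]
  intro ε hε
  have hcomp : IsCompact (ℬ ∩ (Metric.ball β₀ ε)ᶜ) :=
    hcons.compact.inter_right Metric.isOpen_ball.isClosed_compl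
  have hne : ∀ β ∈ ℬ ∩ (Metric.ball β₀ ε)ᶜ, β ≠ β₀ := by
    rintro β ⟨-, hβ⟩ rfl
    exact hβ (Metric.mem_ball_self hε)
  choose! δ hδ hout using fun β (hβ : β ∈ ℬ ∩ (Metric.ball β₀ ε)ᶜ) => hloc β hβ.1 (hne β hβ)
  obtain ⟨t, ht, hcov⟩ := hcomp.elim_nhds_subcover (fun β => Metric.ball β (δ β))
    fun β hβ => Metric.ball_mem_nhds β (hδ β hβ)
  refine ((WithProbToOne.biInter t fun β hβ => hout β (ht β hβ)).inter hβhat).mono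
    (.of_forall fun n => ?_)
  rintro ω ⟨h1, h2⟩
  by_contra hcon
  have hmem : βhat n ω ∈ ℬ ∩ (Metric.ball β₀ ε)ᶜ := ⟨h2.1, fun hb => hcon (by
    rw [Metric.mem_ball, dist_eq_norm] at hb; exact hb)⟩
  obtain ⟨β, hβ, hb⟩ := Set.mem_iUnion₂.1 (hcov hmem)
  exact Set.mem_iInter₂.1 h1 β hβ hb

end ConsistencyTheorem

/-! ### The joint parameter and its components -/

section Parameter

variable {p : ℕ}

/-- `betaPart` as a continuous linear map. -/
def betaPartL (p : ℕ) : Euc (Fin 2 ⊕ Fin p) →L[ℝ] Euc (Fin 2) :=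
  LinearMap.toContinuousLinearMap
    { toFun := betaPart, map_add' := fun _ _ => rfl, map_smul' := fun _ _ => rfl }

/-- `gammaPart` as a continuous linear map. -/
def gammaPartL (p : ℕ) : Euc (Fin 2 ⊕ Fin p) →L[ℝ] Euc (Fin p) :=
  LinearMap.toContinuousLinearMap
    { toFun := gammaPart, map_add' := fun _ _ => rfl, map_smul' := fun _ _ => rfl }

/-- `joinParam` as a continuous linear map on the product space. -/
def joinParamL (p : ℕ) : Euc (Fin 2) × Euc (Fin p) →L[ℝ] Euc (Fin 2 ⊕ Fin p) :=
  LinearMap.toContinuousLinearMap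
    { toFun := fun x => joinParam x.1 x.2
      map_add' := fun x y => by ext (i | i) <;> rfl
      map_smul' := fun c x => by ext (i | i) <;> rfl }

@[simp] lemma betaPartL_apply (θ : Euc (Fin 2 ⊕ Fin p)) : betaPartL p θ = betaPart θ := rfl

@[simp] lemma gammaPartL_apply (θ : Euc (Fin 2 ⊕ Fin p)) : gammaPartL p θ = gammaPart θ := rfl

@[simp] lemma joinParamL_apply (x : Euc (Fin 2) × Euc (Fin p)) :
    joinParamL p x = joinParam x.1 x.2 := rfl

@[simp] lemma betaPart_joinParam (β : Euc (Fin 2)) (γ : Euc (Fin p)) :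
    betaPart (joinParam β γ) = β := rfl

lemma joinParam_single_zero (j : Fin 2) :
    joinParam (EuclideanSpace.single j 1) (0 : Euc (Fin p)) =
      EuclideanSpace.single (Sum.inl j) 1 := by
  ext (i | i) <;> simp [joinParam]

lemma joinParam_zero_single (j : Fin p) :
    joinParam 0 (EuclideanSpace.single j 1) = EuclideanSpace.single (Sum.inr j) 1 := by
  ext (i | i) <;> simp [joinParam]

lemma tendstoInMeasure_joinParam {Ω : Type*} [MeasurableSpace Ω] {P : Measure Ω}
    {βhat : ℕ → Ω → Euc (Fin 2)} {γhat : ℕ → Ω → Euc (Fin p)} {β₀ : Euc (Fin 2)}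
    {γ₀ : Euc (Fin p)} (hβ : TendstoInMeasure P βhat atTop fun _ => β₀)
    (hγ : TendstoInMeasure P γhat atTop fun _ => γ₀) :
    TendstoInMeasure P (fun n ω => joinParam (βhat n ω) (γhat n ω)) atTop
      fun _ => joinParam β₀ γ₀ := by
  rw [tendstoInMeasure_iff_withProbToOne] at hβ hγ ⊢
  intro ε hε
  have hc := (joinParamL p).continuous.tendsto (β₀, γ₀)
  obtain ⟨δ, hδ, hball⟩ := Metric.tendsto_nhds_nhds.1 hc ε hε
  refine ((hβ δ hδ).inter (hγ δ hδ)).mono (.of_forall fun n => ?_)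
  rintro ω ⟨h1, h2⟩
  have := hball (x := (βhat n ω, γhat n ω)) (by
    rw [Prod.dist_eq, max_lt_iff, dist_eq_norm, dist_eq_norm]; exact ⟨h1, h2⟩)
  rwa [dist_eq_norm] at this

end Parameter

/-! ### The expected derivative as a matrix -/

section Jacobian

variable {𝒲 : Type*} [MeasurableSpace 𝒲] {Q : Measure 𝒲} {κ ι : Type} [Fintype κ] [Fintype ι]
  [DecidableEq κ]

/-- Links the operator-valued integral of the expansion with the entrywise expectations in the
influence function: evaluation and coordinates commute with the integral. -/
lemma integral_fderiv_apply {f : 𝒲 → Euc κ → Euc ι} {θ₀ : Euc κ}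
    (hf : Integrable (fun w => fderiv ℝ (f w) θ₀) Q) (u : Euc κ) :
    (∫ w, fderiv ℝ (f w) θ₀ ∂Q) u = WithLp.toLp 2 (expJacobian Q f θ₀ *ᵥ u.ofLp) := by
  have hj : ∀ i j, ((∫ w, fderiv ℝ (f w) θ₀ ∂Q) (EuclideanSpace.single j 1)) i =
      expJacobian Q f θ₀ i j := fun i j => by
    rw [ContinuousLinearMap.integral_apply hf]
    exact ((EuclideanSpace.proj i : Euc ι →L[ℝ] ℝ).integral_comp_comm
      (hf.apply_continuousLinearMap _)).symm
  ext i
  rw [clm_eq_sum_smulRight (∫ w, fderiv ℝ (f w) θ₀ ∂Q)]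
  simp [mulVec, dotProduct, hj, mul_comm]

end Jacobian

/-! ### Partial derivatives of the stacked estimating function -/

section Normality

variable {𝒵 : Type*} {p : ℕ} {ψμ ψσ : ℝ → ℝ} {A B : ℝ} {π : 𝒵 → Euc (Fin p) → ℝ}
  {mγ : ℝ → 𝒵 → Euc (Fin p) → Euc (Fin p)} {β₀ : Euc (Fin 2)} {γ₀ : Euc (Fin p)}

lemma measurable_phiStacked [MeasurableSpace 𝒵] (hψμ : Measurable ψμ) (hψσ : Measurable ψσ)
    (hπ : ∀ γ, Measurable fun z => π z γ) (hmγ : ∀ γ, Measurable fun x : ℝ × 𝒵 => mγ x.1 x.2 γ)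
    (θ : Euc (Fin 2 ⊕ Fin p)) : Measurable fun w => phiStacked ψμ ψσ A B π mγ w θ :=
  (joinParamL p).continuous.measurable.comp
    ((measurable_phi A B hψμ hψσ hπ (betaPart θ) (gammaPart θ)).prodMk
      ((hmγ (gammaPart θ)).comp (measurable_fst.prodMk (measurable_fst.comp measurable_snd))))

/-- Chain rule along `b ↦ joinParam b γ₀`: the weight is constant there and the component `mγ` does
not move. -/
lemma fderiv_phiStacked_inl {w : Obs 𝒵}
    (hw : DifferentiableAt ℝ (phiStacked ψμ ψσ A B π mγ w) (joinParam β₀ γ₀)) (j : Fin 2) :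
    fderiv ℝ (phiStacked ψμ ψσ A B π mγ w) (joinParam β₀ γ₀)
        (EuclideanSpace.single (Sum.inl j) 1) =
      joinParam ((w.1 / π w.2.1 γ₀) •
        fderiv ℝ (mPsi ψμ ψσ A B w.2.2) β₀ (EuclideanSpace.single j 1)) 0 := by
  have hjoin : HasFDerivAt (fun b => joinParam b γ₀)
      ((joinParamL p).comp (ContinuousLinearMap.inl ℝ (Euc (Fin 2)) (Euc (Fin p)))) β₀ :=
    (joinParamL p).hasFDerivAt.comp β₀ (hasFDerivAt_prodMk_left β₀ γ₀)
  have hcomp := hw.hasFDerivAt.comp β₀ hjoin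
  have hβ := ((betaPartL p).hasFDerivAt.comp β₀ hcomp).fderiv
  have hγ := ((gammaPartL p).hasFDerivAt.comp β₀ hcomp).fderiv
  have hβ' : (betaPartL p ∘ phiStacked ψμ ψσ A B π mγ w ∘ fun b => joinParam b γ₀) =
      (w.1 / π w.2.1 γ₀) • mPsi ψμ ψσ A B w.2.2 := rfl
  have hγ' : (gammaPartL p ∘ phiStacked ψμ ψσ A B π mγ w ∘ fun b => joinParam b γ₀) =
      fun _ => mγ w.1 w.2.1 γ₀ := rfl
  rw [hβ', fderiv_const_smul_field] at hβ
  rw [hγ', fderiv_fun_const] at hγ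
  have hβj := DFunLike.congr_fun hβ (EuclideanSpace.single j 1)
  have hγj := DFunLike.congr_fun hγ (EuclideanSpace.single j 1)
  simp only [ContinuousLinearMap.comp_apply, ContinuousLinearMap.inl_apply, joinParamL_apply,
    joinParam_single_zero, betaPartL_apply, gammaPartL_apply] at hβj hγj
  ext (i | i)
  · exact congrArg (fun x : Euc (Fin 2) => x i) hβj.symm
  · exact congrArg (fun x : Euc (Fin p) => x i) hγj.symm

lemma fderiv_phiStacked_inr {w : Obs 𝒵}
    (hw : DifferentiableAt ℝ (phiStacked ψμ ψσ A B π mγ w) (joinParam β₀ γ₀)) (j : Fin p) :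
    fderiv ℝ (phiStacked ψμ ψσ A B π mγ w) (joinParam β₀ γ₀)
        (EuclideanSpace.single (Sum.inr j) 1) =
      joinParam (fderiv ℝ (phi ψμ ψσ A B π w β₀) γ₀ (EuclideanSpace.single j 1))
        (fderiv ℝ (mγ w.1 w.2.1) γ₀ (EuclideanSpace.single j 1)) := by
  have hjoin : HasFDerivAt (fun γ => joinParam β₀ γ)
      ((joinParamL p).comp (ContinuousLinearMap.inr ℝ (Euc (Fin 2)) (Euc (Fin p)))) γ₀ :=
    (joinParamL p).hasFDerivAt.comp γ₀ (hasFDerivAt_prodMk_right β₀ γ₀)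
  have hcomp := hw.hasFDerivAt.comp γ₀ hjoin
  have hβ := ((betaPartL p).hasFDerivAt.comp γ₀ hcomp).fderiv
  have hγ := ((gammaPartL p).hasFDerivAt.comp γ₀ hcomp).fderiv
  have hβ' : (betaPartL p ∘ phiStacked ψμ ψσ A B π mγ w ∘ fun γ => joinParam β₀ γ) =
      phi ψμ ψσ A B π w β₀ := rfl
  have hγ' : (gammaPartL p ∘ phiStacked ψμ ψσ A B π mγ w ∘ fun γ => joinParam β₀ γ) =
      mγ w.1 w.2.1 := rfl
  rw [hβ'] at hβ
  rw [hγ'] at hγ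
  rw [hβ, hγ]
  simp only [ContinuousLinearMap.comp_apply, ContinuousLinearMap.inr_apply, joinParamL_apply,
    joinParam_zero_single, betaPartL_apply, gammaPartL_apply]
  ext (i | i) <;> rfl

end Normality

/-- Solving a block upper triangular linear system. -/
lemma inv_fromBlocks_mulVec_inl {m n : Type*} [Fintype m] [Fintype n] [DecidableEq m]
    [DecidableEq n] {H : Matrix m m ℝ} {K : Matrix m n ℝ} {L : Matrix n n ℝ}
    (h : IsUnit (fromBlocks H K 0 L)) (v : m ⊕ n → ℝ) (i : m) :
    ((fromBlocks H K 0 L)⁻¹ *ᵥ v) (Sum.inl i) =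
      (H⁻¹ *ᵥ (v ∘ Sum.inl - K *ᵥ (L⁻¹ *ᵥ (v ∘ Sum.inr)))) i := by
  have hdet := (isUnit_iff_isUnit_det _).1 h
  have hdet' := hdet
  rw [det_fromBlocks_zero₂₁, IsUnit.mul_iff] at hdet'
  set y := (fromBlocks H K 0 L)⁻¹ *ᵥ v with hy
  have hv : fromBlocks H K 0 L *ᵥ y = v := by
    rw [hy, mulVec_mulVec, mul_nonsing_inv _ hdet, one_mulVec]
  have h1 : H *ᵥ (y ∘ Sum.inl) + K *ᵥ (y ∘ Sum.inr) = v ∘ Sum.inl := by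
    rw [← hv, fromBlocks_mulVec]; rfl
  have h2 : L *ᵥ (y ∘ Sum.inr) = v ∘ Sum.inr := by
    rw [← hv, fromBlocks_mulVec]; simp
  have h3 : L⁻¹ *ᵥ (v ∘ Sum.inr) = y ∘ Sum.inr := by
    rw [← h2, mulVec_mulVec, nonsing_inv_mul _ hdet'.2, one_mulVec]
  rw [h3, ← h1, add_sub_cancel_right, mulVec_mulVec, nonsing_inv_mul _ hdet'.1, one_mulVec]
  rfl

/-! ### Asymptotic normality -/

section NormalityTheorem

variable {Ω 𝒵 : Type*} [MeasurableSpace Ω] [MeasurableSpace 𝒵] {P : Measure Ω}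
  [IsProbabilityMeasure P] {p : ℕ} {R : ℕ → Ω → ℝ} {Z₁ : ℕ → Ω → 𝒵} {Z₂ : ℕ → Ω → ℝ}
  {π : 𝒵 → Euc (Fin p) → ℝ} {Γ : Set (Euc (Fin p))} {γ₀ : Euc (Fin p)} {ℬ : Set (Euc (Fin 2))}
  {β₀ : Euc (Fin 2)} {ψμ ψσ : ℝ → ℝ} {A B : ℝ} {mγ : ℝ → 𝒵 → Euc (Fin p) → Euc (Fin p)}
  {γhat : ℕ → Ω → Euc (Fin p)} {βhat : ℕ → Ω → Euc (Fin 2)}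

/-- The upper left block loses its weight by the weighting identity, applied to a derivative that
depends on `Z₂` only; the lower left block vanishes because `mγ` is free of `β`. -/
lemma expJacobian_phiStacked (hdata : DataModel P R Z₁ Z₂ π γ₀)
    (hdiff : ∀ᵐ w ∂(obsLaw P R Z₁ Z₂),
      DifferentiableAt ℝ (phiStacked ψμ ψσ A B π mγ w) (joinParam β₀ γ₀)) :
    expJacobian (obsLaw P R Z₁ Z₂) (fun w => phiStacked ψμ ψσ A B π mγ w) (joinParam β₀ γ₀) =
      fromBlocks (expJacobian (obsLaw P R Z₁ Z₂) (fun v => mPsi ψμ ψσ A B v.2.2) β₀)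
        (expJacobian (obsLaw P R Z₁ Z₂) (fun v γ => phi ψμ ψσ A B π v β₀ γ) γ₀) 0
        (expJacobian (obsLaw P R Z₁ Z₂) (fun v => mγ v.1 v.2.1) γ₀) := by
  have hL : ∀ j, (fun w => fderiv ℝ (phiStacked ψμ ψσ A B π mγ w) (joinParam β₀ γ₀)
      (EuclideanSpace.single (Sum.inl j) 1)) =ᵐ[obsLaw P R Z₁ Z₂] _ := fun j =>
    hdiff.mono fun w hw => fderiv_phiStacked_inl hw j
  have hR : ∀ j, (fun w => fderiv ℝ (phiStacked ψμ ψσ A B π mγ w) (joinParam β₀ γ₀)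
      (EuclideanSpace.single (Sum.inr j) 1)) =ᵐ[obsLaw P R Z₁ Z₂] _ := fun j =>
    hdiff.mono fun w hw => fderiv_phiStacked_inr hw j
  ext (i | i) (j | j)
  · have hmeas : Measurable fun z : 𝒵 × ℝ =>
        (fderiv ℝ (mPsi ψμ ψσ A B z.2) β₀ (EuclideanSpace.single j 1)) i := by
      have hs : Measurable fun z : 𝒵 × ℝ => β₀ - EuclideanSpace.single 0 z.2 :=
        measurable_const.sub ((((PiLp.continuous_toLp 2 fun _ : Fin 2 => ℝ).comp
          (continuous_single (A := fun _ : Fin 2 => ℝ) 0)).measurable).comp measurable_snd)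
      have hshift : (fun z : 𝒵 × ℝ =>
          (fderiv ℝ (mPsi ψμ ψσ A B z.2) β₀ (EuclideanSpace.single j 1)) i) = fun z =>
          (fderiv ℝ (mPsi ψμ ψσ A B 0) (β₀ - EuclideanSpace.single 0 z.2)
            (EuclideanSpace.single j 1)) i :=
        funext fun z => by rw [fderiv_mPsi_eq_shift ψμ ψσ A B z.2]
      rw [hshift]
      exact (EuclideanSpace.proj i : Euc (Fin 2) →L[ℝ] ℝ).continuous.measurable.comp
        ((measurable_fderiv_apply_const ℝ (mPsi ψμ ψσ A B 0) (EuclideanSpace.single j 1)).comp hs)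
    have := hdata.integral_weight_smul hmeas.stronglyMeasurable
    refine Eq.trans (integral_congr_ae ?_) this
    filter_upwards [hL j] with w hw
    exact congrArg (fun x : Euc (Fin 2 ⊕ Fin p) => x (Sum.inl i)) hw
  · refine integral_congr_ae ?_
    filter_upwards [hR j] with w hw
    exact congrArg (fun x : Euc (Fin 2 ⊕ Fin p) => x (Sum.inl i)) hw
  · refine Eq.trans (integral_congr_ae ?_) (integral_zero _ _)
    filter_upwards [hL j] with w hw
    exact congrArg (fun x : Euc (Fin 2 ⊕ Fin p) => x (Sum.inr i)) hw
  · refine integral_congr_ae ?_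
    filter_upwards [hR j] with w hw
    exact congrArg (fun x : Euc (Fin 2 ⊕ Fin p) => x (Sum.inr i)) hw

/-- Under the conditions for asymptotic normality, the influence function of `βhat` is the
`β`-part of minus the inverse expected Jacobian applied to the stacked estimating function, and
the latter operator is a left inverse of the expected derivative. -/
lemma exists_clm_influence_eq (hdata : DataModel P R Z₁ Z₂ π γ₀)
    (hψμ : Measurable ψμ) (hψσ : Measurable ψσ)
    (hmγ : ∀ γ, Measurable fun x : ℝ × 𝒵 => mγ x.1 x.2 γ)
    (hnorm : NormalityConditions (obsLaw P R Z₁ Z₂) ψμ ψσ A B π mγ ℬ Γ β₀ γ₀) :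
    ∃ K : Euc (Fin 2 ⊕ Fin p) →L[ℝ] Euc (Fin 2 ⊕ Fin p),
      (∀ u, K ((∫ w, fderiv ℝ (phiStacked ψμ ψσ A B π mγ w) (joinParam β₀ γ₀)
        ∂(obsLaw P R Z₁ Z₂)) u) = u) ∧
      ∀ w, influence (obsLaw P R Z₁ Z₂) ψμ ψσ A B π mγ γ₀ β₀ w =
        -betaPart (K (phiStacked ψμ ψσ A B π mγ w (joinParam β₀ γ₀))) := by
  obtain ⟨N, hN, hθ₀, hsmooth, hdom⟩ := hnorm.smooth
  have hdiff : ∀ᵐ w ∂(obsLaw P R Z₁ Z₂), DifferentiableOn ℝ (phiStacked ψμ ψσ A B π mγ w) N :=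
    hsmooth.mono fun w hw => hw.differentiableOn one_ne_zero
  have hdiff₀ : ∀ᵐ w ∂(obsLaw P R Z₁ Z₂),
      DifferentiableAt ℝ (phiStacked ψμ ψσ A B π mγ w) (joinParam β₀ γ₀) :=
    hdiff.mono fun w hw => hw.differentiableAt (hN.mem_nhds hθ₀)
  have hint := integrable_fderiv hN hθ₀ (fun θ => (measurable_phiStacked (A := A) (B := B) hψμ hψσ
    hdata.measurable_π hmγ θ).aestronglyMeasurable) hdiff hdom
  have hblock := expJacobian_phiStacked hdata hdiff₀
  set J := expJacobian (obsLaw P R Z₁ Z₂) (fun w => phiStacked ψμ ψσ A B π mγ w)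
    (joinParam β₀ γ₀) with hJ
  have hunit : IsUnit J := by
    have := (isUnit_iff_isUnit_det _).1 hnorm.nonsingular
    rw [det_mul] at this
    exact (isUnit_iff_isUnit_det _).2 (IsUnit.mul_iff.1 this).2
  have hdet := (isUnit_iff_isUnit_det _).1 hunit
  refine ⟨LinearMap.toContinuousLinearMap (Matrix.toLpLin 2 2 J⁻¹), fun u => ?_, fun w => ?_⟩
  · rw [integral_fderiv_apply hint, ← hJ]
    simp [Matrix.toLpLin_apply, mulVec_mulVec, nonsing_inv_mul _ hdet]
  · ext i
    have := inv_fromBlocks_mulVec_inl (hblock ▸ hunit)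
      (phiStacked ψμ ψσ A B π mγ w (joinParam β₀ γ₀)).ofLp i
    rw [← hblock] at this
    simp only [influence, betaPart]
    refine congrArg Neg.neg ?_
    exact this.symm

theorem tendstoInDistribution_betahat (hdata : DataModel P R Z₁ Z₂ π γ₀)
    (hψμ : Measurable ψμ) (hψσ : Measurable ψσ)
    (hmγ : ∀ γ, Measurable fun x : ℝ × 𝒵 => mγ x.1 x.2 γ)
    (hγhat : WithProbToOne P fun n => {ω | γhat n ω ∈ Γ ∧
      ∑ i ∈ Finset.range n, mγ (R i ω) (Z₁ i ω) (γhat n ω) = 0})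
    (hγhat_lim : TendstoInMeasure P γhat atTop fun _ => γ₀)
    (hβhat_meas : ∀ n, AEMeasurable (βhat n) P)
    (hβhat : WithProbToOne P fun n => {ω | βhat n ω ∈ ℬ ∧
      ∑ i ∈ Finset.range n,
        phi ψμ ψσ A B π (R i ω, Z₁ i ω, Z₂ i ω) (βhat n ω) (γhat n ω) = 0})
    (hβhat_lim : TendstoInMeasure P βhat atTop fun _ => β₀)
    (hnorm : NormalityConditions (obsLaw P R Z₁ Z₂) ψμ ψσ A B π mγ ℬ Γ β₀ γ₀) :
    MemLp (influence (obsLaw P R Z₁ Z₂) ψμ ψσ A B π mγ γ₀ β₀) 2 (obsLaw P R Z₁ Z₂) ∧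
      TendstoInDistribution (fun (n : ℕ) ω => √(n : ℝ) • (βhat n ω - β₀)) atTop id (fun _ => P)
        (multivariateGaussian 0 (secondMoment (obsLaw P R Z₁ Z₂)
          (influence (obsLaw P R Z₁ Z₂) ψμ ψσ A B π mγ γ₀ β₀))) := by
  obtain ⟨K, hK, hIF⟩ := exists_clm_influence_eq hdata hψμ hψσ hmγ hnorm
  obtain ⟨N, hN, hθ₀, hsmooth, hdom⟩ := hnorm.smooth
  have hQ := hdata.isProbabilityMeasure_obsLaw
  have hmeas := measurable_phiStacked (A := A) (B := B) hψμ hψσ hdata.measurable_π hmγ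
  set IF := influence (obsLaw P R Z₁ Z₂) ψμ ψσ A B π mγ γ₀ β₀ with hIFdef
  set T : Euc (Fin 2 ⊕ Fin p) →L[ℝ] Euc (Fin 2) := -((betaPartL p).comp K) with hT
  have hIFT : IF = fun w => T (phiStacked ψμ ψσ A B π mγ w (joinParam β₀ γ₀)) := funext hIF
  have hIFmeas : Measurable IF := by
    rw [hIFT]
    exact T.continuous.measurable.comp (hmeas _)
  have hmem : MemLp IF 2 (obsLaw P R Z₁ Z₂) := by
    rw [hIFT]
    exact T.comp_memLp' hnorm.square_integrable
  have hmean : ∫ w, IF w ∂(obsLaw P R Z₁ Z₂) = 0 := by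
    rw [hIFT, T.integral_comp_comm (hnorm.square_integrable.integrable (by norm_num)),
      hnorm.mean_zero, map_zero]
  refine ⟨hmem, ?_⟩
  have hclt := tendstoInDistribution_inv_sqrt_smul_sum (P := P)
    (X := fun i ω => IF (R i ω, Z₁ i ω, Z₂ i ω))
    (hmem.comp_measurePreserving ⟨hdata.measurable_obs 0, rfl⟩)
    (by rw [← hmean, obsLaw, integral_map (hdata.measurable_obs 0).aemeasurable
      hIFmeas.aestronglyMeasurable])
    (hdata.indep.comp (fun _ => IF) fun _ => hIFmeas) fun i => (hdata.identDistrib i).comp hIFmeas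
  have hsecond : secondMoment P (fun ω => IF (R 0 ω, Z₁ 0 ω, Z₂ 0 ω)) =
      secondMoment (obsLaw P R Z₁ Z₂) IF := by
    ext i j
    have hc : ∀ i, Measurable fun w => IF w i := fun i =>
      (EuclideanSpace.proj i : Euc (Fin 2) →L[ℝ] ℝ).continuous.measurable.comp hIFmeas
    exact (integral_map (hdata.measurable_obs 0).aemeasurable
      ((hc i).mul (hc j)).aestronglyMeasurable).symm
  rw [hsecond] at hclt
  have hzero : WithProbToOne P fun n => {ω | ∑ i ∈ Finset.range n,
      phiStacked ψμ ψσ A B π mγ (R i ω, Z₁ i ω, Z₂ i ω)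
        (joinParam (βhat n ω) (γhat n ω)) = 0} := by
    refine (hγhat.inter hβhat).mono (.of_forall fun n => ?_)
    rintro ω ⟨h1, h2⟩
    have hsum : ∑ i ∈ Finset.range n, phiStacked ψμ ψσ A B π mγ (R i ω, Z₁ i ω, Z₂ i ω)
        (joinParam (βhat n ω) (γhat n ω)) = joinParamL p (∑ i ∈ Finset.range n,
          (phi ψμ ψσ A B π (R i ω, Z₁ i ω, Z₂ i ω) (βhat n ω) (γhat n ω),
            mγ (R i ω) (Z₁ i ω) (γhat n ω))) := by
      rw [map_sum]; rfl
    rw [Set.mem_ofPred_eq, hsum, ← prod_mk_sum, h1.2, h2.2]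
    exact map_zero _
  have hexp := tendstoInMeasure_zEstimator_expansion (P := P)
    (W := fun i ω => (R i ω, Z₁ i ω, Z₂ i ω)) (f := phiStacked ψμ ψσ A B π mγ)
    hdata.measurable_obs hdata.indep hdata.identDistrib hN hθ₀ hmeas
    (hsmooth.mono fun w hw => hw.differentiableOn one_ne_zero) hdom hnorm.mean_zero
    hnorm.square_integrable hK hzero (tendstoInMeasure_joinParam hβhat_lim hγhat_lim)
  -- Slutsky: it remains to show that the scaled error and the normalized sum of influence values
  -- differ by a term vanishing in probability, namely the `β`-part of the expansion remainder.
  refine tendstoInDistribution_of_tendstoInMeasure_sub _ _ hclt ?_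
    fun n => ((hβhat_meas n).sub_const β₀).const_smul (√(n : ℝ))
  rw [tendstoInMeasure_iff_withProbToOne] at hexp ⊢
  intro ε hε
  refine (hexp (ε / (‖betaPartL p‖ + 1)) (by positivity)).mono (.of_forall fun n ω hω => ?_)
  simp only [Set.mem_ofPred_eq, Pi.zero_apply, sub_zero, Pi.sub_apply] at hω ⊢
  have hid : √(n : ℝ) • (βhat n ω - β₀) -
      (√(n : ℝ))⁻¹ • ∑ i ∈ Finset.range n, IF (R i ω, Z₁ i ω, Z₂ i ω) =
      betaPartL p (√(n : ℝ) • (joinParam (βhat n ω) (γhat n ω) - joinParam β₀ γ₀) +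
        K ((√(n : ℝ))⁻¹ • ∑ i ∈ Finset.range n,
          phiStacked ψμ ψσ A B π mγ (R i ω, Z₁ i ω, Z₂ i ω) (joinParam β₀ γ₀))) := by
    simp only [map_add, map_smul, map_sub, map_sum, betaPartL_apply, betaPart_joinParam, hIF,
      Finset.sum_neg_distrib, smul_neg, sub_neg_eq_add]
  rw [hid]
  rw [lt_div_iff₀ (by positivity)] at hω
  refine ((betaPartL p).le_opNorm _).trans_lt ?_
  have := norm_nonneg (√(n : ℝ) • (joinParam (βhat n ω) (γhat n ω) - joinParam β₀ γ₀) +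
        K ((√(n : ℝ))⁻¹ • ∑ i ∈ Finset.range n,
          phiStacked ψμ ψσ A B π mγ (R i ω, Z₁ i ω, Z₂ i ω) (joinParam β₀ γ₀)))
  nlinarith

end NormalityTheorem

/-! ### Boundedness of the influence function in the outcome -/

section Boundedness

lemma norm_mPsi_le {ψμ ψσ : ℝ → ℝ} {Mμ Mσ : ℝ} (hμ : ∀ t, |ψμ t| ≤ Mμ) (hσ : ∀ t, |ψσ t| ≤ Mσ)
    (A B z : ℝ) (β : Euc (Fin 2)) :
    ‖mPsi ψμ ψσ A B z β‖ ≤ (Mμ + |A|) + (Mσ ^ 2 + |B|) := by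
  have h1 : |ψμ ((z - β 0) / β 1) - A| ≤ Mμ + |A| :=
    (abs_sub _ _).trans (by gcongr; exact hμ _)
  have h2 : |ψσ ((z - β 0) / β 1) ^ 2 - B| ≤ Mσ ^ 2 + |B| := by
    refine (abs_sub _ _).trans ?_
    rw [abs_pow]
    gcongr
    exact hσ _
  rw [EuclideanSpace.norm_eq, Fin.sum_univ_two]
  have h3 := abs_nonneg (ψμ ((z - β 0) / β 1) - A)
  have h4 := abs_nonneg (ψσ ((z - β 0) / β 1) ^ 2 - B)
  refine Real.sqrt_le_iff.2 ⟨by linarith, ?_⟩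
  simp only [mPsi, Real.norm_eq_abs, cons_val_zero, cons_val_one]
  nlinarith

/-- For fixed `r` and `z₁` the influence function is a fixed affine map of `mPsi`. This needs no
invertibility: the matrix inverses enter only as constant matrices. -/
theorem exists_norm_influence_le {𝒵 : Type*} [MeasurableSpace 𝒵] (Q : Measure (Obs 𝒵)) {p : ℕ}
    {ψμ ψσ : ℝ → ℝ} (hμ : ∃ M, ∀ t, |ψμ t| ≤ M) (hσ : ∃ M, ∀ t, |ψσ t| ≤ M) (A B : ℝ)
    (π : 𝒵 → Euc (Fin p) → ℝ) (mγ : ℝ → 𝒵 → Euc (Fin p) → Euc (Fin p)) (γ₀ : Euc (Fin p))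
    (β : Euc (Fin 2)) (r : ℝ) (z₁ : 𝒵) :
    ∃ C, ∀ z₂ : ℝ, ‖influence Q ψμ ψσ A B π mγ γ₀ β (r, z₁, z₂)‖ ≤ C := by
  obtain ⟨Mμ, hμ⟩ := hμ
  obtain ⟨Mσ, hσ⟩ := hσ
  let T := LinearMap.toContinuousLinearMap
    (Matrix.toLpLin 2 2 (expJacobian Q (fun v => mPsi ψμ ψσ A B v.2.2) β)⁻¹ :
      Euc (Fin 2) →ₗ[ℝ] Euc (Fin 2))
  let c : Euc (Fin 2) := WithLp.toLp 2 (expJacobian Q (fun v γ => phi ψμ ψσ A B π v β γ) γ₀ *ᵥ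
    ((expJacobian Q (fun v => mγ v.1 v.2.1) γ₀)⁻¹ *ᵥ (mγ r z₁ γ₀).ofLp))
  have hIF : ∀ z₂, influence Q ψμ ψσ A B π mγ γ₀ β (r, z₁, z₂) =
      -T ((r / π z₁ γ₀) • mPsi ψμ ψσ A B z₂ β - c) := fun z₂ => rfl
  refine ⟨‖T‖ * (‖r / π z₁ γ₀‖ * ((Mμ + |A|) + (Mσ ^ 2 + |B|)) + ‖c‖), fun z₂ => ?_⟩
  rw [hIF, norm_neg]
  refine (T.le_opNorm _).trans ?_
  gcongr
  refine (norm_sub_le _ _).trans ?_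
  rw [norm_smul]
  gcongr
  exact norm_mPsi_le hμ hσ A B z₂ β

end Boundedness

end RIPW

end

open RIPW in
/-- Consistency, asymptotic normality, and boundedness of the influence function, of the robust
inverse probability weighted estimator `βhat n = (μhat, σhat)'` of `β₀ = (μ₀, σ₀)'`. -/
theorem proposition1 {Ω 𝒵 : Type*} [MeasurableSpace Ω] [MeasurableSpace 𝒵]
    (P : Measure Ω) [IsProbabilityMeasure P] {p : ℕ}
    -- data, and the model for the missingness probability
    (R : ℕ → Ω → ℝ) (Z₁ : ℕ → Ω → 𝒵) (Z₂ : ℕ → Ω → ℝ)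
    (π : 𝒵 → Euc (Fin p) → ℝ) (Γ : Set (Euc (Fin p))) (γ₀ : Euc (Fin p))
    (hdata : DataModel P R Z₁ Z₂ π γ₀)
    -- location-scale parameter, `ψ` functions and centering constants
    (ℬ : Set (Euc (Fin 2))) (hℬ : ∀ β ∈ ℬ, 0 < β 1) (β₀ : Euc (Fin 2)) (hβ₀ : β₀ ∈ ℬ)
    (ψμ ψσ : ℝ → ℝ) (hψμ : Measurable ψμ) (hψσ : Measurable ψσ) (A B : ℝ)
    (hA : A = ∫ ω, ψμ ((Z₂ 0 ω - β₀ 0) / β₀ 1) ∂P)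
    (hB : B = ∫ ω, ψσ ((Z₂ 0 ω - β₀ 0) / β₀ 1) ^ 2 ∂P)
    -- the estimator of `γ`
    (mγ : ℝ → 𝒵 → Euc (Fin p) → Euc (Fin p))
    (hmγ : ∀ γ, Measurable fun x : ℝ × 𝒵 => mγ x.1 x.2 γ)
    (γhat : ℕ → Ω → Euc (Fin p)) (hγhat_meas : ∀ n, AEMeasurable (γhat n) P)
    (hγhat : WithProbToOne P fun n => {ω | γhat n ω ∈ Γ ∧
      ∑ i ∈ Finset.range n, mγ (R i ω) (Z₁ i ω) (γhat n ω) = 0})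
    (hγhat_lim : TendstoInMeasure P γhat atTop fun _ => γ₀)
    -- the robust inverse probability weighted estimator
    (βhat : ℕ → Ω → Euc (Fin 2)) (hβhat_meas : ∀ n, AEMeasurable (βhat n) P)
    (hβhat : WithProbToOne P fun n => {ω | βhat n ω ∈ ℬ ∧
      ∑ i ∈ Finset.range n,
        phi ψμ ψσ A B π (R i ω, Z₁ i ω, Z₂ i ω) (βhat n ω) (γhat n ω) = 0}) :
    -- consistency
    (ConsistencyConditions (obsLaw P R Z₁ Z₂) ψμ ψσ A B π ℬ β₀ γ₀ →
      TendstoInMeasure P βhat atTop fun _ => β₀) ∧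
    -- asymptotic normality
    (TendstoInMeasure P βhat atTop (fun _ => β₀) →
      NormalityConditions (obsLaw P R Z₁ Z₂) ψμ ψσ A B π mγ ℬ Γ β₀ γ₀ →
      MemLp (influence (obsLaw P R Z₁ Z₂) ψμ ψσ A B π mγ γ₀ β₀) 2 (obsLaw P R Z₁ Z₂) ∧
      TendstoInDistribution (fun (n : ℕ) ω => √(n : ℝ) • (βhat n ω - β₀)) atTop id (fun _ => P)
        (multivariateGaussian 0 (secondMoment (obsLaw P R Z₁ Z₂)
          (influence (obsLaw P R Z₁ Z₂) ψμ ψσ A B π mγ γ₀ β₀)))) ∧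
    -- the influence function is bounded in `z₂` if the `ψ` functions are bounded
    ((∃ M, ∀ t, |ψμ t| ≤ M) → (∃ M, ∀ t, |ψσ t| ≤ M) →
      ∀ (β : Euc (Fin 2)) (r : ℝ) (z₁ : 𝒵), ∃ C, ∀ z₂ : ℝ,
        ‖influence (obsLaw P R Z₁ Z₂) ψμ ψσ A B π mγ γ₀ β (r, z₁, z₂)‖ ≤ C) := by
  refine ⟨fun hcons => ?_, fun hlim hnorm => ?_, fun hμ hσ β r z₁ => ?_⟩
  · exact tendstoInMeasure_betahat hdata hψμ hψσ hγhat_lim hβhat hcons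
  · exact tendstoInDistribution_betahat hdata hψμ hψσ hmγ hγhat hγhat_lim hβhat_meas hβhat hlim
      hnorm
  · exact exists_norm_influence_le _ hμ hσ A B π mγ γ₀ β r z₁
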